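/- Let $n\ge 1$, let $g_0,g_1,\dots$ be a real impulse response, and let $G\in\mathbb{R}^{n\times n}$ be the lower triangular Toeplitz matrix with $G_{ij}=g_{i-j}$ for $i\ge j$ and $G_{ij}=0$ for $i<j$. Put $$A(c)=G^\top G-c\,(G+G^\top)+c^2 I_n,\qquad \rho_3(c,u)=\frac{u^\top A(c)u}{\|u\|^2}\quad(c\in\mathbb{R},\ u\in\mathbb{R}^n\setminus\{0\}),$$ $$r_{\min}^2=\inf_{c\in\mathbb{R}}\ \sup_{u\neq 0}\rho_3(c,u),$$ and let $\lambda_1(A(c))$ be the largest eigenvalue of $A(c)$. Call $(c^\star,u^\star)\in\mathbb{R}\times S^{n-1}$ a minimal-radius pair if $c^\star$ minimizes $c\mapsto\lambda_1(A(c))$ over $\mathbb{R}$, $u^\star$ is a unit eigenvector of $A(c^\star)$ for $\lambda_1(A(c^\star))$, and $2c^\star-u^{\star\top}(G+G^\top)u^\star=0$. Consider the saddle-point flow $$\dot c=-\nabla_c\rho_3(c,u),\qquad \dot u=\nabla_u\rho_3(c,u)$$ on $\mathbb{R}\times S^{n-1}$. **Theorem.** Minimal-radius pairs exist, and they all have the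 same $c^\star$. Every minimal-radius pair $(c^\star,u^\star)$ is an equilibrium of the flow and satisfies $\rho_3(c^\star,u^\star)=r_{\min}^2$. If moreover $\lambda_1(A(c^\star))$ is an eigenvalue of $A(c^\star)$ * of multiplicity one, or * of multiplicity two, and (Assumption 1) $u^{\star\top}(G+G^\top)v_2\neq0$, where $v_2$ is an eigenvector of $A(c^\star)$ for $\lambda_1(A(c^\star))$ orthogonal to $u^\star$ (unique up to a nonzero factor), then $(c^\star,u^\star)$ is locally exponentially stable under the flow on $\mathbb{R}\times S^{n-1}$: there are $\delta,K,\alpha>0$ such that from every $x_0\in\mathbb{R}\times S^{n-1}$ with $\|x_0-(c^\star,u^\star)\|<\delta$ there is a solution for all $t\ge0$, and every solution $x$ starting at such an $x_0$ stays in $\mathbb{R}\times S^{n-1}$ and satisfies $\|x(t)-(c^\star,u^\star)\|\le Ke^{-\alpha t}\|x_0-(c^\star,u^\star)\|$ for as long as it is defined, $t\ge0$. -/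

import Mathlib

open Set

noncomputable section

/-- The lower triangular Toeplitz matrix of the convolution operator `y(t) = ∑ k, g k * u (t - k)`
restricted to inputs of length `n`. -/
def convolutionMatrix (n : ℕ) (g : ℕ → ℝ) : Matrix (Fin n) (Fin n) ℝ :=
  Matrix.of fun i j => if (j : ℕ) ≤ (i : ℕ) then g ((i : ℕ) - (j : ℕ)) else 0

/-- `A(c) = Gᵀ G - c (G + Gᵀ) + c² I`. -/
def conicMatrix {n : ℕ} (G : Matrix (Fin n) (Fin n) ℝ) (c : ℝ) : Matrix (Fin n) (Fin n) ℝ :=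
  G.transpose * G - c • (G + G.transpose) + c ^ 2 • (1 : Matrix (Fin n) (Fin n) ℝ)

/-- The quadratic/bilinear form `uᵀ M v` of a real matrix on Euclidean space. -/
def bilin {n : ℕ} (M : Matrix (Fin n) (Fin n) ℝ) (u v : EuclideanSpace ℝ (Fin n)) : ℝ :=
  inner ℝ u (Matrix.toEuclideanLin M v)

/-- The Rayleigh quotient `ρ₃(c, u) = uᵀ A(c) u / ‖u‖²` (relevant for `u ≠ 0`). -/
def rho3 {n : ℕ} (G : Matrix (Fin n) (Fin n) ℝ) (c : ℝ) (u : EuclideanSpace ℝ (Fin n)) : ℝ :=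
  bilin (conicMatrix G c) u u / ‖u‖ ^ 2

/-- The squared minimal cone radius `r²_min = inf_c sup_{u ≠ 0} ρ₃(c, u)`. -/
def minRadiusSq {n : ℕ} (G : Matrix (Fin n) (Fin n) ℝ) : ℝ :=
  ⨅ c : ℝ, ⨆ u : {u : EuclideanSpace ℝ (Fin n) // u ≠ 0}, rho3 G c u

/-- The largest (real) eigenvalue `λ₁(M)`; used for symmetric matrices of positive size. -/
def lambda1 {n : ℕ} (M : Matrix (Fin n) (Fin n) ℝ) : ℝ :=
  sSup {μ : ℝ | Module.End.HasEigenvalue (Matrix.toEuclideanLin M) μ}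

/-- The multiplicity of `λ₁(M)`, i.e. the dimension of its eigenspace. -/
def lambda1Multiplicity {n : ℕ} (M : Matrix (Fin n) (Fin n) ℝ) : ℕ :=
  Module.finrank ℝ (Module.End.eigenspace (Matrix.toEuclideanLin M) (lambda1 M))

/-- `(c, u)` is a pair `(c⋆, u⋆)` giving the minimal radius: `c` minimizes `λ₁(A(·))`, and `u` is
a unit eigenvector of `A(c)` for `λ₁(A(c))` chosen such that `2 c - uᵀ (G + Gᵀ) u = 0`. -/
structure IsMinRadiusPair {n : ℕ} (G : Matrix (Fin n) (Fin n) ℝ) (c : ℝ)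
    (u : EuclideanSpace ℝ (Fin n)) : Prop where
  isMinOn : IsMinOn (fun c' : ℝ => lambda1 (conicMatrix G c')) univ c
  norm_eq_one : ‖u‖ = 1
  eigenvector : Module.End.HasEigenvector (Matrix.toEuclideanLin (conicMatrix G c))
    (lambda1 (conicMatrix G c)) u
  center_eq : 2 * c - bilin (G + G.transpose) u u = 0

/-- The additional assumption for a double eigenvalue `λ₁(A(c))`: `v₁ᵀ (G + Gᵀ) v₂ ≠ 0`, where
`v₁ = u` and `v₂` is an eigenvector for `λ₁(A(c))` orthogonal to `v₁` (if the eigenspace has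
dimension two, `v₂` is unique up to a nonzero factor). -/
def Assumption1 {n : ℕ} (G : Matrix (Fin n) (Fin n) ℝ) (c : ℝ)
    (u : EuclideanSpace ℝ (Fin n)) : Prop :=
  ∃ v₂ : EuclideanSpace ℝ (Fin n),
    Module.End.HasEigenvector (Matrix.toEuclideanLin (conicMatrix G c))
      (lambda1 (conicMatrix G c)) v₂ ∧
    inner ℝ v₂ u = 0 ∧ bilin (G + G.transpose) u v₂ ≠ 0

/-- The saddle-point vector field `(-∇_c ρ₃(c, u), ∇_u ρ₃(c, u))`: gradient descent in `c` and
gradient ascent in `u`. -/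
def saddleField {n : ℕ} (G : Matrix (Fin n) (Fin n) ℝ)
    (x : ℝ × EuclideanSpace ℝ (Fin n)) : ℝ × EuclideanSpace ℝ (Fin n) :=
  (-deriv (fun c : ℝ => rho3 G c x.2) x.1,
    gradient (fun u : EuclideanSpace ℝ (Fin n) => rho3 G x.1 u) x.2)

/-- The manifold `ℝ × S^{n-1}`. -/
def stateManifold (n : ℕ) : Set (ℝ × EuclideanSpace ℝ (Fin n)) :=
  univ ×ˢ Metric.sphere (0 : EuclideanSpace ℝ (Fin n)) 1

/-- `x₀ ∈ M` is an equilibrium of `x' = F x` that is locally exponentially stable for initial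
values in the set `M`: from each point of `M` near `x₀` a solution exists for all times
`t ≥ 0`, and every solution (on any time interval `[0, T]`) starting in `M` near `x₀`
stays in `M` and satisfies `‖x t - x₀‖ ≤ K e^{-α t} ‖x 0 - x₀‖`. -/
def IsLocallyExpStableOn {X : Type*} [NormedAddCommGroup X] [NormedSpace ℝ X]
    (F : X → X) (M : Set X) (x₀ : X) : Prop :=
  x₀ ∈ M ∧ F x₀ = 0 ∧
  ∃ δ > (0 : ℝ), ∃ K > (0 : ℝ), ∃ α > (0 : ℝ),
    (∀ y ∈ M, ‖y - x₀‖ < δ →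
      ∃ γ : ℝ → X, γ 0 = y ∧ IsIntegralCurveOn γ (fun _ => F) (Ici 0)) ∧
    (∀ (γ : ℝ → X) (T : ℝ), IsIntegralCurveOn γ (fun _ => F) (Icc 0 T) →
      γ 0 ∈ M → ‖γ 0 - x₀‖ < δ →
      ∀ t ∈ Icc 0 T, γ t ∈ M ∧ ‖γ t - x₀‖ ≤ K * Real.exp (-α * t) * ‖γ 0 - x₀‖)

end

/-! For fixed unit `u`, `ρ₃(c, u)` is a quadratic in `c` with leading coefficient 1, and `λ₁(A(c))`
is the maximum of these over the sphere. So it is continuous, coercive and strongly convex in `c`,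
which gives a unique minimizer. At the minimizer, optimality from either side yields top
eigenvectors with `uᵀ(G + Gᵀ)u ≤ 2c` and `≥ 2c`; an intermediate value argument inside the
eigenspace gives equality (`exists_isMinRadiusPair`).

For stability put `S = G + Gᵀ`, `T = A(c⋆) - λ₁ ≤ 0`, `q = S u⋆ - 2c⋆ u⋆`, `z = c - c⋆`, `w = u -
u⋆`. The linearized flow is `z' = 2⟨q, w⟩ - 2z`, `w' = 2Tw - 2zq`. Along it `z² + ‖w‖²` has
derivative `-4z² + 4⟨w, Tw⟩`, which gives no decay on `ker T`. The cross term `-2εz⟨q, w⟩`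
contributes `-4ε⟨q, w⟩²`, and this repairs the defect exactly when no nonzero vector of `ker T ∩
u⋆ᗮ` is orthogonal to `q`. A simple eigenvalue or Assumption 1 guarantees that
(`eq_zero_of_mem_eigenspace_of_orthogonal`). The direction `u⋆` itself is harmless: on the sphere
`⟨u⋆, w⟩ = -‖w‖²/2` is of second order.

The decay estimate (`exists_saddleLyapunov_decay`) is converted into existence and exponential
convergence by Lyapunov's direct method (`isLocallyExpStableOn_of_lyapunov`). -/

open scoped NNReal Topology

/-! ### Integral curves and Lyapunov's direct method -/

/-- A bounded, globally Lipschitz vector field has forward-complete integral curves. -/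
theorem exists_isIntegralCurveOn_Ici_of_lipschitzWith {X : Type*} [NormedAddCommGroup X]
    [NormedSpace ℝ X] [CompleteSpace X] {f : X → X} {K L : ℝ≥0} (hf : LipschitzWith K f)
    (hL : ∀ x, ‖f x‖ ≤ L) (x : X) :
    ∃ γ : ℝ → X, γ 0 = x ∧ IsIntegralCurveOn γ (fun _ => f) (Ici 0) := by
  have key : ∀ N : ℕ, ∃ γ : ℝ → X, γ 0 = x ∧
      IsIntegralCurveOn γ (fun _ => f) (Icc (0 : ℝ) N) := by
    intro N
    have h0 : (0 : ℝ) ∈ Icc (0 : ℝ) N := ⟨le_rfl, N.cast_nonneg⟩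
    -- A curve of speed at most `L` travels at most `L * N` in time `N`, so a ball of this radius
    -- leaves the time interval unrestricted.
    have hp : IsPicardLindelof (fun _ => f) (⟨0, h0⟩ : Icc (0 : ℝ) N) x (L * N) 0 L K :=
      IsPicardLindelof.of_time_independent (fun y _ => hL y) hf.lipschitzOnWith (by simp)
    exact hp.exists_eq_forall_mem_Icc_hasDerivWithinAt₀
  choose γ hγ0 hγ using key
  have hright : ∀ (N : ℕ) (T : ℝ), T ≤ N → ∀ t ∈ Ico 0 T,
      HasDerivWithinAt (γ N) (f (γ N t)) (Ici t) t := by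
    intro N T hT t ht
    refine (hγ N t ⟨ht.1, ht.2.le.trans hT⟩).mono_of_mem_nhdsWithin ?_
    exact Filter.mem_of_superset (Icc_mem_nhdsGE (ht.2.trans_le hT))
      (Icc_subset_Icc_left ht.1)
  have huniq : ∀ M N : ℕ, ∀ t : ℝ, 0 ≤ t → t ≤ M → t ≤ N → γ M t = γ N t := by
    intro M N t h0 hM hN
    refine ODE_solution_unique (v := fun _ => f) (fun _ => hf)
      ((hγ M).continuousOn.mono (Icc_subset_Icc_right hM)) (hright M t hM)
      ((hγ N).continuousOn.mono (Icc_subset_Icc_right hN)) (hright N t hN)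
      ((hγ0 M).trans (hγ0 N).symm) ⟨h0, le_rfl⟩
  -- The index `⌊t⌋₊ + 1` makes `t < N` strict even at integers, so `Icc 0 N` is a neighbourhood of
  -- `t` in `Ici 0`; there the glued curve coincides with `γ N` by uniqueness.
  refine ⟨fun t => γ (⌊t⌋₊ + 1) t, hγ0 _, fun t ht => ?_⟩
  set N : ℕ := ⌊t⌋₊ + 1
  have htN : t < N := by simpa [N] using Nat.lt_floor_add_one t
  have hmem : Icc (0 : ℝ) N ∈ 𝓝[Ici 0] t := by
    rw [← Ici_inter_Iic]
    exact Filter.inter_mem self_mem_nhdsWithin (mem_nhdsWithin_of_mem_nhds (Iic_mem_nhds htN))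
  refine ((hγ N t ⟨ht, htN.le⟩).mono_of_mem_nhdsWithin hmem).congr_of_eventuallyEq ?_ rfl
  filter_upwards [hmem] with s hs
  exact huniq _ _ s hs.1 (by simpa using (Nat.lt_floor_add_one s).le) hs.2

/-- A first integral is constant along integral curves. -/
theorem IsIntegralCurveOn.eq_of_firstIntegral {X : Type*} [NormedAddCommGroup X]
    [NormedSpace ℝ X] {F : X → X} {h : X → ℝ} {h' : X → X →L[ℝ] ℝ}
    (hh : ∀ x, HasFDerivAt h (h' x) x) (hF : ∀ x, h' x (F x) = 0) {γ : ℝ → X} {T : ℝ}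
    (hγ : IsIntegralCurveOn γ (fun _ => F) (Icc 0 T)) {t : ℝ} (ht : t ∈ Icc 0 T) :
    h (γ t) = h (γ 0) := by
  have hd : ∀ s ∈ Icc 0 T, HasDerivWithinAt (fun s => h (γ s)) 0 (Icc 0 T) s := by
    intro s hs
    have := (hh (γ s)).comp_hasDerivWithinAt s (hγ s hs)
    rw [hF] at this
    exact this
  refine constant_of_has_deriv_right_zero (f := fun s => h (γ s))
    (fun s hs => (hd s hs).continuousWithinAt)
    (fun s hs => (hd s ⟨hs.1, hs.2.le⟩).mono_of_mem_nhdsWithin ?_) t ht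
  exact Filter.mem_of_superset (Icc_mem_nhdsGE hs.2) (Icc_subset_Icc_left hs.1)

/-- Exponential decay of a Lyapunov function along integral curves staying in a region where the
Lyapunov inequality holds. -/
theorem IsIntegralCurveOn.lyapunov_le_exp {X : Type*} [NormedAddCommGroup X]
    [NormedSpace ℝ X] {F : X → X} {V : X → ℝ} {V' : X → X →L[ℝ] ℝ}
    (hV : ∀ x, HasFDerivAt V (V' x) x) {α : ℝ} {γ : ℝ → X} {T : ℝ}
    (hγ : IsIntegralCurveOn γ (fun _ => F) (Icc 0 T))
    (hdec : ∀ s ∈ Ioo 0 T, V' (γ s) (F (γ s)) ≤ -(2 * α) * V (γ s)) {t : ℝ} (ht : t ∈ Icc 0 T) :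
    V (γ t) ≤ Real.exp (-α * t) ^ 2 * V (γ 0) := by
  set g : ℝ → ℝ := fun s => Real.exp (2 * α * s) * V (γ s)
  have hVd : ∀ s ∈ Icc 0 T, HasDerivWithinAt (fun s => V (γ s)) (V' (γ s) (F (γ s))) (Icc 0 T) s :=
    fun s hs => (hV (γ s)).comp_hasDerivWithinAt s (hγ s hs)
  have hg : ∀ s ∈ Icc 0 T, HasDerivWithinAt g
      (Real.exp (2 * α * s) * (2 * α) * V (γ s) + Real.exp (2 * α * s) * V' (γ s) (F (γ s)))
      (Icc 0 T) s := by
    intro s hs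
    refine HasDerivWithinAt.mul ?_ (hVd s hs)
    have := ((hasDerivAt_id s).const_mul (2 * α)).exp
    simpa using this.hasDerivWithinAt
  have hanti : AntitoneOn g (Icc 0 T) := by
    refine antitoneOn_of_hasDerivWithinAt_nonpos (convex_Icc 0 T)
      (fun s hs => (hg s hs).continuousWithinAt)
      (fun s hs => (hg s (interior_subset hs)).mono interior_subset) (fun s hs => ?_)
    rw [interior_Icc] at hs
    have h1 := hdec s hs
    have h2 := Real.exp_pos (2 * α * s)
    nlinarith
  have h0 : (0 : ℝ) ∈ Icc 0 T := ⟨le_rfl, ht.1.trans ht.2⟩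
  have h1 : Real.exp (2 * α * t) * V (γ t) ≤ V (γ 0) := by
    simpa [g] using hanti h0 ht ht.1
  have h2 : Real.exp (-α * t) ^ 2 * Real.exp (2 * α * t) = 1 := by
    rw [← Real.exp_nat_mul, ← Real.exp_add]
    ring_nf
    exact Real.exp_zero
  calc V (γ t) = Real.exp (-α * t) ^ 2 * (Real.exp (2 * α * t) * V (γ t)) := by
        rw [← mul_assoc, h2, one_mul]
    _ ≤ _ := by gcongr

/-- Lyapunov's direct method on an invariant set, for a Lyapunov function comparable with the
squared distance. -/
theorem IsIntegralCurveOn.norm_sub_le_of_lyapunov {X : Type*} [NormedAddCommGroup X]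
    [NormedSpace ℝ X] {F : X → X} {V : X → ℝ} {V' : X → X →L[ℝ] ℝ} {M : Set X} {x₀ : X}
    (hV : ∀ x, HasFDerivAt V (V' x) x) {a k α r : ℝ} (ha : 0 < a) (hk : 0 < k) (hα : 0 ≤ α)
    (hVa : ∀ x, a * ‖x - x₀‖ ^ 2 ≤ V x) (hVb : ∀ x, V x ≤ a * (k * ‖x - x₀‖) ^ 2)
    (hdec : ∀ x ∈ M, ‖x - x₀‖ < r → V' x (F x) ≤ -(2 * α) * V x)
    {γ : ℝ → X} {T : ℝ} (hγ : IsIntegralCurveOn γ (fun _ => F) (Icc 0 T))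
    (hγM : ∀ t ∈ Icc 0 T, γ t ∈ M) (hγ0 : k * ‖γ 0 - x₀‖ < r) {t : ℝ} (ht : t ∈ Icc 0 T) :
    ‖γ t - x₀‖ < r ∧ ‖γ t - x₀‖ ≤ k * Real.exp (-α * t) * ‖γ 0 - x₀‖ := by
  -- Closeness is required only on the open interval, so that the estimate applies at a first exit
  -- time.
  have step : ∀ t₁ ∈ Icc 0 T, (∀ s ∈ Ioo 0 t₁, ‖γ s - x₀‖ < r) →
      ‖γ t₁ - x₀‖ ≤ k * Real.exp (-α * t₁) * ‖γ 0 - x₀‖ := by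
    intro t₁ ht₁ hs
    have h := (hγ.mono (Icc_subset_Icc_right ht₁.2)).lyapunov_le_exp hV
      (fun s hs' => hdec _ (hγM s ⟨hs'.1.le, hs'.2.le.trans ht₁.2⟩) (hs s hs'))
      ⟨ht₁.1, le_rfl⟩
    have h1 : a * ‖γ t₁ - x₀‖ ^ 2 ≤ a * (k * Real.exp (-α * t₁) * ‖γ 0 - x₀‖) ^ 2 := by
      calc a * ‖γ t₁ - x₀‖ ^ 2 ≤ _ := hVa _
        _ ≤ _ := h
        _ ≤ Real.exp (-α * t₁) ^ 2 * (a * (k * ‖γ 0 - x₀‖) ^ 2) := by gcongr; exact hVb _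
        _ = _ := by ring
    exact le_of_sq_le_sq (le_of_mul_le_mul_left h1 ha) (by positivity)
  have small : ∀ t₁ ∈ Icc 0 T, (∀ s ∈ Ioo 0 t₁, ‖γ s - x₀‖ < r) → ‖γ t₁ - x₀‖ < r := by
    intro t₁ ht₁ hs
    refine (step t₁ ht₁ hs).trans_lt (lt_of_le_of_lt ?_ hγ0)
    have : Real.exp (-α * t₁) ≤ 1 := Real.exp_le_one_iff.2 (by nlinarith [ht₁.1])
    have h2 : k * Real.exp (-α * t₁) ≤ k := by nlinarith
    gcongr
  have all : ∀ s ∈ Icc 0 T, ‖γ s - x₀‖ < r := by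
    by_contra! hcon
    obtain ⟨s, hs, hsr⟩ := hcon
    have hcl : IsCompact (Icc 0 T ∩ (fun s => ‖γ s - x₀‖) ⁻¹' Ici r) :=
      isCompact_Icc.of_isClosed_subset
        (((hγ.continuousOn.sub continuousOn_const).norm).preimage_isClosed_of_isClosed
          isClosed_Icc isClosed_Ici) inter_subset_left
    -- `t₁` is the first time the curve reaches distance `r`; the decay up to `t₁` keeps it strictly
    -- inside.
    obtain ⟨t₁, ht₁, hmin⟩ := hcl.exists_isLeast ⟨s, hs, hsr⟩
    refine absurd (small t₁ ht₁.1 fun s' hs' => ?_) (not_lt.2 ht₁.2)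
    by_contra hge
    exact absurd (hmin ⟨⟨hs'.1.le, hs'.2.le.trans ht₁.1.2⟩, not_lt.1 hge⟩) (not_le.2 hs'.2)
  exact ⟨all t ht, step t ht fun s hs => all s ⟨hs.1.le, hs.2.le.trans ht.2⟩⟩

/-- Local exponential stability on a level set of a first integral, from a local Lyapunov
inequality there; `P` is a `C¹` vector field agreeing with `F` on the level set. -/
theorem isLocallyExpStableOn_of_lyapunov {X : Type*} [NormedAddCommGroup X]
    [NormedSpace ℝ X] [FiniteDimensional ℝ X] {F P : X → X} {M : Set X} {x₀ : X}
    {h : X → ℝ} {h' : X → X →L[ℝ] ℝ} {c₀ : ℝ}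
    (hh : ∀ x, HasFDerivAt h (h' x) x) (hF : ∀ x, h' x (F x) = 0) (hP : ∀ x, h' x (P x) = 0)
    (hM : ∀ x, x ∈ M ↔ h x = c₀) (hFP : EqOn F P M) (hPsmooth : ContDiff ℝ 1 P)
    (hx₀ : x₀ ∈ M) (hFx₀ : F x₀ = 0) {V : X → ℝ} {V' : X → X →L[ℝ] ℝ}
    (hV : ∀ x, HasFDerivAt V (V' x) x) {a k α r : ℝ} (ha : 0 < a) (hk : 0 < k) (hα : 0 < α)
    (hr : 0 < r) (hVa : ∀ x, a * ‖x - x₀‖ ^ 2 ≤ V x)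
    (hVb : ∀ x, V x ≤ a * (k * ‖x - x₀‖) ^ 2)
    (hdec : ∀ x ∈ M, ‖x - x₀‖ < r → V' x (P x) ≤ -(2 * α) * V x) :
    IsLocallyExpStableOn F M x₀ := by
  have : CompleteSpace X := FiniteDimensional.complete ℝ X
  refine ⟨hx₀, hFx₀, r / k, div_pos hr hk, k, hk, α, hα, ?_, ?_⟩
  · intro y hy hyr
    -- Cutting `P` off makes it bounded and globally Lipschitz. The cut-off field is still tangent
    -- to the level sets of `h`, and it equals `P` on the `r`-ball, which its curves never leave
    -- when they start in `M` within `r / k` of `x₀`.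
    let χ : ContDiffBump x₀ := ⟨r, 2 * r, hr, by linarith⟩
    set f : X → X := fun x => χ x • P x with hf
    have hfc : ContDiff ℝ 1 f := χ.contDiff.smul hPsmooth
    have hfs : HasCompactSupport f := χ.hasCompactSupport.smul_right
    obtain ⟨K, hK⟩ := ContDiff.lipschitzWith_of_hasCompactSupport (𝕂 := ℝ) hfs hfc one_ne_zero
    obtain ⟨L, hL⟩ := hfs.exists_bound_of_continuous hfc.continuous
    obtain ⟨γ, hγ0, hγ⟩ := exists_isIntegralCurveOn_Ici_of_lipschitzWith (L := L.toNNReal) hK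
      (fun x => (hL x).trans (Real.le_coe_toNNReal L)) y
    have hfh : ∀ x, h' x (f x) = 0 := fun x => by simp [hf, hP]
    have hIcc : ∀ T : ℝ, IsIntegralCurveOn γ (fun _ => f) (Icc 0 T) :=
      fun T => hγ.mono Icc_subset_Ici_self
    have hγM : ∀ t ∈ Ici (0 : ℝ), γ t ∈ M := fun t ht => by
      rw [hM, (hIcc t).eq_of_firstIntegral hh hfh ⟨ht, le_rfl⟩, hγ0]
      exact (hM y).1 hy
    have hχ : ∀ x, ‖x - x₀‖ < r → f x = P x := fun x hx => by
      simp only [hf]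
      rw [χ.one_of_mem_closedBall (by simpa [dist_eq_norm] using hx.le), one_smul]
    refine ⟨γ, hγ0, fun t ht => ?_⟩
    have hlt : ‖γ t - x₀‖ < r :=
      ((hIcc t).norm_sub_le_of_lyapunov (M := M) hV ha hk hα.le hVa hVb
        (fun x hx hxr => by rw [hχ x hxr]; exact hdec x hx hxr)
        (fun s hs => hγM s hs.1) (by rw [hγ0, mul_comm]; exact (lt_div_iff₀ hk).1 hyr)
        ⟨ht, le_rfl⟩).1
    have := hγ t ht
    simp only at this ⊢
    rwa [hFP (hγM t ht), ← hχ _ hlt]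
  · intro γ T hγ hγ0 hγr t ht
    have hγM : ∀ t ∈ Icc 0 T, γ t ∈ M := fun t ht => by
      rw [hM, hγ.eq_of_firstIntegral hh hF ht]
      exact (hM _).1 hγ0
    exact ⟨hγM t ht, (hγ.norm_sub_le_of_lyapunov (M := M) hV ha hk hα.le hVa hVb
      (fun x hx hxr => by rw [hFP hx]; exact hdec x hx hxr) hγM
      (by rw [mul_comm]; exact (lt_div_iff₀ hk).1 hγr) ht).2⟩

/-! ### Degenerate quadratic forms -/

section Quadratic

variable {E : Type*} [NormedAddCommGroup E] [InnerProductSpace ℝ E]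

/-- A vector on which a negative semidefinite symmetric form vanishes is in its kernel. -/
theorem eq_zero_of_inner_map_self_eq_zero {T : E →L[ℝ] E}
    (hT : ∀ v w, inner ℝ v (T w) = inner ℝ (T v) w)
    (hneg : ∀ w, inner ℝ w (T w) ≤ 0) {w : E} (hw : inner ℝ w (T w) = 0) : T w = 0 := by
  set b : ℝ := inner ℝ (T w) (T (T w))
  -- The form at `w + s • T w` has linear term `2s‖T w‖²`, which would make it positive for small `s
  -- > 0`.
  have key : ∀ s : ℝ, 2 * s * ‖T w‖ ^ 2 + s ^ 2 * b ≤ 0 := by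
    intro s
    have h := hneg (w + s • T w)
    simp only [map_add, map_smul, inner_add_left, inner_add_right, real_inner_smul_left,
      real_inner_smul_right, hw, hT w, real_inner_self_eq_norm_sq] at h
    linarith
  have hb : b ≤ 0 := hneg (T w)
  by_contra hne
  have hpos : 0 < ‖T w‖ ^ 2 := by positivity
  have hden : 0 < 1 - b := by linarith
  -- With this `s` one has `‖T w‖² = s(1 - b)`, and the left side becomes `s²(2 - b) > 0`.
  have h := key (‖T w‖ ^ 2 / (1 - b))
  have h2 : 0 < ‖T w‖ ^ 2 / (1 - b) := div_pos hpos hden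
  have h3 : ‖T w‖ ^ 2 / (1 - b) * (1 - b) = ‖T w‖ ^ 2 := div_mul_cancel₀ _ hden.ne'
  set s := ‖T w‖ ^ 2 / (1 - b)
  rw [← h3] at h
  nlinarith [mul_pos h2 h2]

/-- Coercivity of a degenerate form supplemented by the squares of two functionals that separate
its kernel. -/
theorem exists_coercive_const [FiniteDimensional ℝ E] {T : E →L[ℝ] E}
    (hT : ∀ v w, inner ℝ v (T w) = inner ℝ (T v) w) (hneg : ∀ w, inner ℝ w (T w) ≤ 0) {q u₀ : E}
    (hnd : ∀ w, T w = 0 → inner ℝ u₀ w = 0 → inner ℝ q w = 0 → w = 0) :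
    ∃ κ > (0 : ℝ), ∀ w, κ * ‖w‖ ^ 2 ≤
      -inner ℝ w (T w) + inner ℝ q w ^ 2 + inner ℝ u₀ w ^ 2 := by
  set f : E → ℝ := fun w => -inner ℝ w (T w) + inner ℝ q w ^ 2 + inner ℝ u₀ w ^ 2 with hf
  have hfc : Continuous f := by fun_prop
  have hpos : ∀ w, w ≠ 0 → 0 < f w := by
    intro w hw
    have h1 := hneg w
    by_contra hle
    have hle' : -inner ℝ w (T w) + inner ℝ q w ^ 2 + inner ℝ u₀ w ^ 2 ≤ 0 := not_lt.1 hle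
    have hq : inner ℝ q w ^ 2 = 0 := by nlinarith [sq_nonneg (inner ℝ q w), sq_nonneg (inner ℝ u₀ w)]
    have hu : inner ℝ u₀ w ^ 2 = 0 := by
      nlinarith [sq_nonneg (inner ℝ q w), sq_nonneg (inner ℝ u₀ w)]
    have ht : inner ℝ w (T w) = 0 := by nlinarith
    exact hw (hnd w (eq_zero_of_inner_map_self_eq_zero hT hneg ht) (by simpa using hu)
      (by simpa using hq))
  have hscale : ∀ (s : ℝ) w, f (s • w) = s ^ 2 * f w := by
    intro s w
    simp only [hf, map_smul, real_inner_smul_left, real_inner_smul_right]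
    ring
  -- The sphere is empty only if `E` is trivial. Otherwise `κ` is the minimum of `f` on it, and
  -- 2-homogeneity extends the bound to all `w`.
  rcases (Metric.sphere (0 : E) 1).eq_empty_or_nonempty with he | hne
  · refine ⟨1, one_pos, fun w => ?_⟩
    have hw : w = 0 := by
      by_contra hw
      have : ‖w‖⁻¹ • w ∈ Metric.sphere (0 : E) 1 := by
        simp [norm_smul, inv_mul_cancel₀ (norm_ne_zero_iff.2 hw)]
      simp [he] at this
    simp [hw]
  · obtain ⟨v, hv, hmin⟩ := (isCompact_sphere (0 : E) 1).exists_isMinOn hne hfc.continuousOn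
    have hv0 : v ≠ 0 := by rintro rfl; simp at hv
    refine ⟨f v, hpos v hv0, fun w => ?_⟩
    by_cases hw : w = 0
    · simp [hw]
    have hwn : ‖w‖ ≠ 0 := norm_ne_zero_iff.2 hw
    have hmem : ‖w‖⁻¹ • w ∈ Metric.sphere (0 : E) 1 := by simp [norm_smul, inv_mul_cancel₀ hwn]
    have h1 : f v ≤ f (‖w‖⁻¹ • w) := hmin hmem
    rw [hscale] at h1
    change f v * ‖w‖ ^ 2 ≤ f w
    calc f v * ‖w‖ ^ 2 ≤ (‖w‖⁻¹ ^ 2 * f w) * ‖w‖ ^ 2 := by gcongr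
      _ = f w := by field_simp

/-! ### Polynomial model of the saddle-point field and its linearization -/

/-- The field `(⟨u, S u⟩ - 2 c, 2 (‖u‖² N u - ⟨u, N u⟩ u))` with `N = T - (c - c₀) S`: a polynomial
field, tangent to all spheres, that agrees on the unit sphere with the saddle-point field of
`(c, u) ↦ ⟨u, N u⟩ / ‖u‖² + c² + const`, where `⟨u, N u⟩` is affine in `c`. -/
noncomputable def polySaddleField (S T : E →L[ℝ] E) (c₀ : ℝ) (x : ℝ × E) : ℝ × E :=
  (inner ℝ x.2 (S x.2) - 2 * x.1,
    (2 : ℝ) • ((inner ℝ x.2 x.2 : ℝ) • (T x.2 - (x.1 - c₀) • S x.2) -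
      (inner ℝ x.2 (T x.2 - (x.1 - c₀) • S x.2) : ℝ) • x.2))

theorem contDiff_polySaddleField (S T : E →L[ℝ] E) (c₀ : ℝ) :
    ContDiff ℝ 1 (polySaddleField S T c₀) := by
  unfold polySaddleField
  have h1 : ContDiff ℝ 1 fun x : ℝ × E => T x.2 - (x.1 - c₀) • S x.2 := by fun_prop
  exact ((contDiff_snd.inner ℝ (S.contDiff.comp contDiff_snd)).sub
    (contDiff_const.mul contDiff_fst)).prodMk (contDiff_const.smul
      (((contDiff_snd.inner ℝ contDiff_snd).smul h1).sub
        ((contDiff_snd.inner ℝ h1).smul contDiff_snd)))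

theorem inner_polySaddleField_snd (S T : E →L[ℝ] E) (c₀ : ℝ) (x : ℝ × E) :
    inner ℝ x.2 (polySaddleField S T c₀ x).2 = 0 := by
  simp only [polySaddleField, inner_sub_right, real_inner_smul_right]
  ring

/-- The linear part of the saddle-point field at an equilibrium, with a quadratic remainder. -/
theorem exists_polySaddleField_remainder_bound {S T : E →L[ℝ] E}
    (hS : ∀ v w, inner ℝ v (S w) = inner ℝ (S v) w)
    (hT : ∀ v w, inner ℝ v (T w) = inner ℝ (T v) w) {c₀ : ℝ} {u₀ : E} (hu₀ : ‖u₀‖ = 1)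
    (hTu₀ : T u₀ = 0) (hc₀ : inner ℝ u₀ (S u₀) = 2 * c₀) :
    ∃ C : ℝ, 0 ≤ C ∧ ∀ (z : ℝ) (w : E), ‖u₀ + w‖ = 1 → ∃ (r : ℝ) (R : E),
      polySaddleField S T c₀ (c₀ + z, u₀ + w) =
        (2 * inner ℝ (S u₀ - (2 * c₀) • u₀) w - 2 * z + r,
          (2 : ℝ) • T w - (2 * z) • (S u₀ - (2 * c₀) • u₀) + R) ∧
      |r| ≤ C * ‖w‖ ^ 2 ∧ ‖R‖ ≤ C * ((|z| + ‖w‖) * ‖w‖) := by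
  -- `2|c₀| + ‖S‖` suffices for `r`. In `R`, the three terms containing `S` contribute `2 + 4 + 2 =
  -- 8` times `‖S‖`, and the last term contributes `2‖T‖`.
  refine ⟨2 * |c₀| + 8 * ‖S‖ + 2 * ‖T‖, by positivity, fun z w hw => ?_⟩
  have hwS : |inner ℝ w (S w)| ≤ ‖S‖ * ‖w‖ ^ 2 := by
    calc |inner ℝ w (S w)| ≤ ‖w‖ * ‖S w‖ := abs_real_inner_le_norm _ _
      _ ≤ ‖w‖ * (‖S‖ * ‖w‖) := by gcongr; exact S.le_opNorm w
      _ = _ := by ring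
  have hwT : |inner ℝ w (T w)| ≤ ‖T‖ * ‖w‖ ^ 2 := by
    calc |inner ℝ w (T w)| ≤ ‖w‖ * ‖T w‖ := abs_real_inner_le_norm _ _
      _ ≤ ‖w‖ * (‖T‖ * ‖w‖) := by gcongr; exact T.le_opNorm w
      _ = _ := by ring
  set u := u₀ + w with hu
  have huu : (inner ℝ u u : ℝ) = 1 := by rw [real_inner_self_eq_norm_sq, hw]; norm_num
  have hu₀u₀ : (inner ℝ u₀ u₀ : ℝ) = 1 := by rw [real_inner_self_eq_norm_sq, hu₀]; norm_num
  have hu₀w : 2 * inner ℝ u₀ w = -‖w‖ ^ 2 := by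
    have := huu
    rw [hu, inner_add_left, inner_add_right, inner_add_right, hu₀u₀, real_inner_comm u₀ w,
      real_inner_self_eq_norm_sq] at this
    linarith
  have huSu : |inner ℝ u (S u)| ≤ ‖S‖ := by
    calc |inner ℝ u (S u)| ≤ ‖u‖ * ‖S u‖ := abs_real_inner_le_norm _ _
      _ ≤ ‖u‖ * (‖S‖ * ‖u‖) := by gcongr; exact S.le_opNorm u
      _ = _ := by rw [hw]; ring
  have hdiff : |inner ℝ u (S u) - 2 * c₀| ≤ 2 * ‖S‖ * ‖w‖ := by
    have h1 : inner ℝ u (S u) - 2 * c₀ = inner ℝ w (S u) + inner ℝ u₀ (S w) := by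
      rw [← hc₀, hu]; simp only [map_add, inner_add_left, inner_add_right]; ring
    rw [h1]
    calc _ ≤ |inner ℝ w (S u)| + |inner ℝ u₀ (S w)| := abs_add_le _ _
      _ ≤ ‖w‖ * ‖S u‖ + ‖u₀‖ * ‖S w‖ :=
        add_le_add (abs_real_inner_le_norm _ _) (abs_real_inner_le_norm _ _)
      _ ≤ ‖w‖ * (‖S‖ * ‖u‖) + ‖u₀‖ * (‖S‖ * ‖w‖) := by
        gcongr
        · exact S.le_opNorm u
        · exact S.le_opNorm w
      _ = _ := by rw [hw, hu₀]; ring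
  -- The term `-2c₀‖w‖²` is the cost of replacing `S u₀` by its tangential part `S u₀ - 2c₀ u₀` in
  -- the linear term, since `2⟨u₀, w⟩ = -‖w‖²`.
  refine ⟨-2 * c₀ * ‖w‖ ^ 2 + inner ℝ w (S w),
    (2 * z * inner ℝ u (S u)) • w + (2 * z * (inner ℝ u (S u) - 2 * c₀)) • u₀ - (2 * z) • S w
      - (2 * inner ℝ w (T w)) • u, ?_, ?_, ?_⟩
  · have hTu : T u = T w := by rw [hu, map_add, hTu₀, zero_add]
    have huTu : inner ℝ u (T u) = inner ℝ w (T w) := by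
      rw [hTu, hu, inner_add_left, hT u₀, hTu₀, inner_zero_left, zero_add]
    have huTw : inner ℝ u (T w) = inner ℝ w (T w) := hTu ▸ huTu
    refine Prod.ext ?_ ?_
    · have h1 : inner ℝ u (S u) = 2 * c₀ + 2 * inner ℝ (S u₀) w + inner ℝ w (S w) := by
        rw [hu]
        simp only [map_add, inner_add_left, inner_add_right, hc₀, hS u₀ w]
        rw [real_inner_comm (S u₀) w]; ring
      simp only [polySaddleField, h1, inner_sub_left, real_inner_smul_left]
      linear_combination (2 * c₀) * hu₀w
    · simp only [polySaddleField, huu, inner_sub_right, real_inner_smul_right, huTw, hTu,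
        add_sub_cancel_left]
      have h2 : S u = S u₀ + S w := by rw [hu, map_add]
      generalize inner ℝ u (S u) = s
      rw [h2, hu]
      module
  · calc _ ≤ |-2 * c₀ * ‖w‖ ^ 2| + |inner ℝ w (S w)| := abs_add_le _ _
      _ ≤ 2 * |c₀| * ‖w‖ ^ 2 + ‖S‖ * ‖w‖ ^ 2 := by
        gcongr
        rw [abs_mul, abs_mul]; simp
      _ ≤ _ := by nlinarith [norm_nonneg S, norm_nonneg T, sq_nonneg ‖w‖, mul_nonneg (norm_nonneg S) (sq_nonneg ‖w‖), mul_nonneg (norm_nonneg T) (sq_nonneg ‖w‖)]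
  · calc _ ≤ ‖(2 * z * inner ℝ u (S u)) • w‖ + ‖(2 * z * (inner ℝ u (S u) - 2 * c₀)) • u₀‖
          + ‖(2 * z) • S w‖ + ‖(2 * inner ℝ w (T w)) • u‖ :=
        (norm_sub_le _ _).trans (add_le_add_left ((norm_sub_le _ _).trans
          (add_le_add_left (norm_add_le _ _) _)) _)
      _ ≤ 2 * |z| * ‖S‖ * ‖w‖ + 2 * |z| * (2 * ‖S‖ * ‖w‖) * 1 + 2 * |z| * (‖S‖ * ‖w‖)
          + 2 * (‖T‖ * ‖w‖ ^ 2) * 1 := by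
        simp only [norm_smul, Real.norm_eq_abs, abs_mul, abs_two, hu₀, hw]
        gcongr
        exact S.le_opNorm w
      _ ≤ _ := by
        nlinarith [mul_nonneg (mul_nonneg (norm_nonneg T) (abs_nonneg z)) (norm_nonneg w),
          mul_nonneg (norm_nonneg S) (sq_nonneg ‖w‖), mul_nonneg (abs_nonneg c₀) (sq_nonneg ‖w‖),
          mul_nonneg (mul_nonneg (abs_nonneg c₀) (abs_nonneg z)) (norm_nonneg w),
          mul_nonneg (mul_nonneg (norm_nonneg S) (abs_nonneg z)) (norm_nonneg w)]

/-! ### The Lyapunov function with cross term and its decay -/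

/-- The quadratic Lyapunov function `z² + ‖w‖² - 2 ε z ⟨q, w⟩` in the deviations
`z = c - c₀`, `w = u - u₀`. -/
noncomputable def saddleLyapunov (ε c₀ : ℝ) (u₀ q : E) (x : ℝ × E) : ℝ :=
  (x.1 - c₀) ^ 2 + ‖x.2 - u₀‖ ^ 2 - 2 * ε * ((x.1 - c₀) * inner ℝ q (x.2 - u₀))

/-- The derivative of `saddleLyapunov`. -/
noncomputable def saddleLyapunovDeriv (ε c₀ : ℝ) (u₀ q : E) (x : ℝ × E) : ℝ × E →L[ℝ] ℝ :=
  (2 * (x.1 - c₀) - 2 * ε * inner ℝ q (x.2 - u₀)) • ContinuousLinearMap.fst ℝ ℝ E +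
    (innerSL ℝ ((2 : ℝ) • (x.2 - u₀) - (2 * ε * (x.1 - c₀)) • q)).comp
      (ContinuousLinearMap.snd ℝ ℝ E)

theorem hasFDerivAt_saddleLyapunov (ε c₀ : ℝ) (u₀ q : E) (x : ℝ × E) :
    HasFDerivAt (saddleLyapunov ε c₀ u₀ q) (saddleLyapunovDeriv ε c₀ u₀ q x) x := by
  have hz : HasFDerivAt (fun x : ℝ × E => x.1 - c₀) (ContinuousLinearMap.fst ℝ ℝ E) x :=
    hasFDerivAt_fst.sub_const c₀
  have hw : HasFDerivAt (fun x : ℝ × E => x.2 - u₀) (ContinuousLinearMap.snd ℝ ℝ E) x :=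
    hasFDerivAt_snd.sub_const u₀
  have hq : HasFDerivAt (fun x : ℝ × E => inner ℝ q (x.2 - u₀))
      ((innerSL ℝ q).comp (ContinuousLinearMap.snd ℝ ℝ E)) x :=
    (innerSL ℝ q).hasFDerivAt.comp x hw
  refine (((hz.pow 2).add hw.norm_sq).sub ((hz.mul hq).const_mul (2 * ε))).congr_fderiv ?_
  ext y
  · simp [saddleLyapunovDeriv]
  · simp [saddleLyapunovDeriv]
    ring

/-- The scalar inequality behind the decay of the Lyapunov function. -/
theorem lyapunov_scalar_bound {ε κ n τ C ρ z W p t m r R₁ R₂ : ℝ} (hε : 0 < ε) (hε1 : ε ≤ 1)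
    (hC : 0 ≤ C) (hW : 0 ≤ W) (hzρ : |z| ≤ ρ) (hWρ : W ≤ ρ) (hρ1 : ρ ≤ 1)
    (hεn : ε * n ≤ 1 / 2) (hεn2 : 4 * ε * n ^ 2 ≤ 1) (hεκ : ε * (n * (1 + τ)) ^ 2 ≤ κ)
    (ht : t ≤ 0) (hco : κ * W ^ 2 ≤ -t + p ^ 2 + (W ^ 2 / 2) ^ 2)
    (hp : |p| ≤ n * W) (hm : |m| ≤ n * (τ * W)) (hr : |r| ≤ C * W ^ 2)
    (hR₁ : |R₁| ≤ W * (C * ((|z| + W) * W))) (hR₂ : |R₂| ≤ n * (C * ((|z| + W) * W))) :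
    2 * z * (2 * p - 2 * z + r) + 2 * (2 * t - 2 * z * p + R₁) -
        2 * ε * ((2 * p - 2 * z + r) * p + z * (2 * m - 2 * z * n ^ 2 + R₂)) ≤
      -z ^ 2 - 2 * ε * κ * W ^ 2 + (10 * C + 1) * ρ * (z ^ 2 + W ^ 2) := by
  have hρ : 0 ≤ ρ := hW.trans hWρ
  have hz0 := abs_nonneg z
  have hz2 : |z| ^ 2 = z ^ 2 := sq_abs z
  -- `e1` to `e5` bound the higher-order terms by multiples of `ρ(z² + W²)`; `e6` to `e8` treat the
  -- quadratic part.
  have e1 : 2 * z * r ≤ 2 * C * ρ * W ^ 2 := by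
    calc 2 * z * r ≤ |2 * z * r| := le_abs_self _
      _ = 2 * |z| * |r| := by rw [abs_mul, abs_mul, abs_two]
      _ ≤ 2 * ρ * (C * W ^ 2) := by gcongr
      _ = _ := by ring
  have e2 : 2 * R₁ ≤ 4 * C * ρ * W ^ 2 := by
    have : W * (C * ((|z| + W) * W)) ≤ W * (C * ((ρ + ρ) * W)) := by gcongr
    have := le_abs_self R₁
    nlinarith
  have e3 : -(2 * ε * (r * p)) ≤ C * ρ * W ^ 2 := by
    calc -(2 * ε * (r * p)) ≤ |2 * ε * (r * p)| := neg_le_abs _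
      _ = 2 * ε * (|r| * |p|) := by rw [abs_mul, abs_mul, abs_mul, abs_two, abs_of_pos hε]
      _ ≤ 2 * ε * ((C * W ^ 2) * (n * W)) := by gcongr
      _ = 2 * (ε * n) * (C * W ^ 2 * W) := by ring
      _ ≤ 2 * (1 / 2) * (C * W ^ 2 * ρ) := by gcongr
      _ = _ := by ring
  have e4 : -(2 * ε * (z * R₂)) ≤ 2 * C * ρ * (z ^ 2 + W ^ 2) := by
    calc -(2 * ε * (z * R₂)) ≤ |2 * ε * (z * R₂)| := neg_le_abs _
      _ = 2 * ε * (|z| * |R₂|) := by rw [abs_mul, abs_mul, abs_mul, abs_two, abs_of_pos hε]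
      _ ≤ 2 * ε * (|z| * (n * (C * ((|z| + W) * W)))) := by gcongr
      _ = 2 * (ε * n) * C * ((|z| + W) * (|z| * W)) := by ring
      _ ≤ 2 * (1 / 2) * C * ((ρ + ρ) * (z ^ 2 + W ^ 2)) := by
        gcongr
        nlinarith [sq_nonneg (|z| - W)]
      _ = _ := by ring
  have e5 : ε * W ^ 4 ≤ ρ * W ^ 2 := by
    calc ε * W ^ 4 ≤ 1 * W ^ 4 := by gcongr
      _ = W * W * W ^ 2 := by ring
      _ ≤ ρ * 1 * W ^ 2 := by gcongr; linarith
      _ = _ := by ring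
  -- Young's inequality. Of the available `-4z²`, this uses `2z²` and `e7` uses `z²`; of the
  -- `-4εκW²` from `e8`, this uses half.
  have e6 : 4 * ε * (z * (p - m)) ≤ 2 * z ^ 2 + 2 * ε * κ * W ^ 2 := by
    have hpm : |p - m| ≤ n * (1 + τ) * W := by
      calc |p - m| ≤ |p| + |m| := abs_sub _ _
        _ ≤ _ := by linarith
    have h1 : 4 * ε * (z * (p - m)) ≤ 4 * |z| * (ε * (n * (1 + τ) * W)) := by
      calc 4 * ε * (z * (p - m)) ≤ 4 * ε * |z * (p - m)| := by gcongr; exact le_abs_self _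
        _ = 4 * ε * (|z| * |p - m|) := by rw [abs_mul]
        _ ≤ 4 * ε * (|z| * (n * (1 + τ) * W)) := by gcongr
        _ = _ := by ring
    have h2 : 4 * |z| * (ε * (n * (1 + τ) * W)) ≤ 2 * z ^ 2 + 2 * (ε * (n * (1 + τ) * W)) ^ 2 := by
      rw [← hz2]; nlinarith [sq_nonneg (|z| - ε * (n * (1 + τ) * W))]
    have h3 : 2 * (ε * (n * (1 + τ) * W)) ^ 2 ≤ 2 * ε * κ * W ^ 2 := by
      calc _ = 2 * ε * (ε * (n * (1 + τ)) ^ 2) * W ^ 2 := by ring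
        _ ≤ _ := by gcongr
    linarith
  have e7 : 4 * ε * n ^ 2 * z ^ 2 ≤ z ^ 2 := by nlinarith [sq_nonneg z]
  have e8 : 4 * t - 4 * ε * p ^ 2 ≤ -4 * ε * κ * W ^ 2 + ε * W ^ 4 := by
    -- As `t ≤ 0` and `ε ≤ 1`, `4t ≤ 4εt`; then `ε` times the coercivity inequality applies.
    have h1 : 0 ≤ (1 - ε) * -t := mul_nonneg (by linarith) (by linarith)
    have h2 := mul_le_mul_of_nonneg_left hco hε.le
    linarith
  linarith [mul_nonneg (mul_nonneg hC hρ) (sq_nonneg z), mul_nonneg (mul_nonneg hC hρ) (sq_nonneg W),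
    mul_nonneg hρ (sq_nonneg z)]

/-- The Lyapunov function is comparable with the squared distance. -/
theorem saddleLyapunov_bounds {ε : ℝ} (hε : 0 ≤ ε) {q : E} (hεq : ε * ‖q‖ ≤ 1 / 2) (c₀ : ℝ)
    (u₀ : E) (x : ℝ × E) :
    ((x.1 - c₀) ^ 2 + ‖x.2 - u₀‖ ^ 2) / 2 ≤ saddleLyapunov ε c₀ u₀ q x ∧
      saddleLyapunov ε c₀ u₀ q x ≤ 3 / 2 * ((x.1 - c₀) ^ 2 + ‖x.2 - u₀‖ ^ 2) := by
  have h : |2 * ε * ((x.1 - c₀) * inner ℝ q (x.2 - u₀))| ≤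
      ((x.1 - c₀) ^ 2 + ‖x.2 - u₀‖ ^ 2) / 2 := by
    calc _ = 2 * ε * (|x.1 - c₀| * |inner ℝ q (x.2 - u₀)|) := by
          rw [abs_mul, abs_mul, abs_mul, abs_two, abs_of_nonneg hε]
      _ ≤ 2 * ε * (|x.1 - c₀| * (‖q‖ * ‖x.2 - u₀‖)) := by
        gcongr; exact abs_real_inner_le_norm _ _
      _ = 2 * (ε * ‖q‖) * (|x.1 - c₀| * ‖x.2 - u₀‖) := by ring
      _ ≤ 2 * (1 / 2) * (|x.1 - c₀| * ‖x.2 - u₀‖) := by gcongr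
      _ ≤ _ := by
        rw [← sq_abs (x.1 - c₀)]
        nlinarith [sq_nonneg (|x.1 - c₀| - ‖x.2 - u₀‖)]
  rw [abs_le] at h
  unfold saddleLyapunov
  constructor <;> linarith [h.1, h.2]

/-- Near an equilibrium whose transversal Hessian data are nondegenerate, a suitable
`saddleLyapunov` decays exponentially along the saddle-point field on the unit sphere. -/
theorem exists_saddleLyapunov_decay [FiniteDimensional ℝ E] {S T : E →L[ℝ] E}
    (hS : ∀ v w, inner ℝ v (S w) = inner ℝ (S v) w)
    (hT : ∀ v w, inner ℝ v (T w) = inner ℝ (T v) w) (hneg : ∀ w, inner ℝ w (T w) ≤ 0)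
    {c₀ : ℝ} {u₀ : E} (hu₀ : ‖u₀‖ = 1)
    (hTu₀ : T u₀ = 0) (hc₀ : inner ℝ u₀ (S u₀) = 2 * c₀)
    (hnd : ∀ w, T w = 0 → inner ℝ u₀ w = 0 → inner ℝ (S u₀) w = 0 → w = 0) :
    ∃ ε > (0 : ℝ), ε * ‖S u₀ - (2 * c₀) • u₀‖ ≤ 1 / 2 ∧ ∃ α > (0 : ℝ), ∃ r > (0 : ℝ),
      ∀ x : ℝ × E, ‖x.2‖ = 1 → ‖x - (c₀, u₀)‖ < r →
        saddleLyapunovDeriv ε c₀ u₀ (S u₀ - (2 * c₀) • u₀) x (polySaddleField S T c₀ x) ≤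
          -(2 * α) * saddleLyapunov ε c₀ u₀ (S u₀ - (2 * c₀) • u₀) x := by
  set q := S u₀ - (2 * c₀) • u₀ with hq
  obtain ⟨κ, hκ, hco⟩ := exists_coercive_const (q := q) (u₀ := u₀) hT hneg (by
    intro w h1 h2 h3
    refine hnd w h1 h2 ?_
    rw [hq, inner_sub_left, real_inner_smul_left, h2] at h3
    linarith)
  obtain ⟨C, hC, hrem⟩ := exists_polySaddleField_remainder_bound hS hT hu₀ hTu₀ hc₀
  set n := ‖q‖ with hn
  set τ := ‖T‖ with hτ
  have hn0 : 0 ≤ n := norm_nonneg _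
  have hτ0 : 0 ≤ τ := norm_nonneg _
  -- Each summand of `B` is a lower bound needed for `1/ε`; summing them meets all four smallness
  -- conditions at once.
  set B : ℝ := 1 + 2 * n + 4 * n ^ 2 + (n * (1 + τ)) ^ 2 / κ with hB
  have hdiv : 0 ≤ (n * (1 + τ)) ^ 2 / κ := by positivity
  have hBpos : 0 < B := by positivity
  have hεle : ∀ y, y ≤ B → 1 / B * y ≤ 1 := fun y hy => by
    rw [one_div_mul_eq_div, div_le_one hBpos]; exact hy
  have hε : 0 < 1 / B := by positivity
  have hε1 := hεle 1 (by nlinarith [sq_nonneg n])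
  have hε2 := hεle (2 * n) (by nlinarith [sq_nonneg n])
  have hε3 := hεle (4 * n ^ 2) (by nlinarith [sq_nonneg n])
  have hε4 := hεle ((n * (1 + τ)) ^ 2 / κ) (by nlinarith [sq_nonneg n])
  generalize 1 / B = ε at hε hε1 hε2 hε3 hε4
  have hεκ : ε * (n * (1 + τ)) ^ 2 ≤ κ := by
    rwa [← mul_div_assoc, div_le_one hκ] at hε4
  -- The quadratic part decays at least like `-μ(z² + ‖w‖²)`, and `ρ` is chosen so that the
  -- remainder consumes at most half. Since `V ≤ 3/2 (z² + ‖w‖²)`, what is left is at most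
  -- `-(μ/3)V`, so the rate is `α = μ/6`.
  set μ : ℝ := min 1 (2 * ε * κ) with hμ
  have hμpos : 0 < μ := lt_min one_pos (by positivity)
  set ρ : ℝ := min 1 (μ / 2 / (10 * C + 1)) with hρ
  have hρpos : 0 < ρ := lt_min one_pos (by positivity)
  refine ⟨ε, hε, by linarith, μ / 6, by positivity, ρ, hρpos, ?_⟩
  rintro ⟨c, u⟩ hu hlt
  obtain ⟨z, rfl⟩ : ∃ z, c = c₀ + z := ⟨c - c₀, by ring⟩
  obtain ⟨w, rfl⟩ : ∃ w, u = u₀ + w := ⟨u - u₀, by abel⟩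
  have hzw : |z| < ρ ∧ ‖w‖ < ρ := by
    simpa [Prod.norm_def] using hlt
  obtain ⟨r, R, hP, hr, hR⟩ := hrem z w hu
  rw [← hq] at hP
  have hu₀w : inner ℝ u₀ w = -(‖w‖ ^ 2 / 2) := by
    have h : ‖u₀ + w‖ ^ 2 = ‖u₀‖ ^ 2 + 2 * inner ℝ u₀ w + ‖w‖ ^ 2 := norm_add_sq_real u₀ w
    rw [show ‖u₀ + w‖ = 1 from hu, hu₀] at h
    linarith
  have hbound := lyapunov_scalar_bound (ε := ε) (κ := κ) (n := n) (τ := τ) (C := C) (ρ := ρ) (z := z)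
    (W := ‖w‖) (p := inner ℝ q w) (t := inner ℝ w (T w)) (m := inner ℝ q (T w)) (r := r)
    (R₁ := inner ℝ w R) (R₂ := inner ℝ q R) hε (by linarith) hC (norm_nonneg w) hzw.1.le
    hzw.2.le (min_le_left _ _) (by linarith) (by linarith) hεκ (hneg w)
    (by have := hco w; rw [hu₀w] at this; linarith [neg_sq (‖w‖ ^ 2 / 2)])
    (abs_real_inner_le_norm _ _)
    ((abs_real_inner_le_norm _ _).trans (by gcongr; exact T.le_opNorm w)) hr
    ((abs_real_inner_le_norm _ _).trans (by gcongr))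
    ((abs_real_inner_le_norm _ _).trans (by gcongr))
  have hV := (saddleLyapunov_bounds (q := q) hε.le (by linarith) c₀ u₀ (c₀ + z, u₀ + w)).2
  simp only [add_sub_cancel_left] at hV
  have hderiv : saddleLyapunovDeriv ε c₀ u₀ q (c₀ + z, u₀ + w)
      (polySaddleField S T c₀ (c₀ + z, u₀ + w)) =
      2 * z * (2 * inner ℝ q w - 2 * z + r) +
        2 * (2 * inner ℝ w (T w) - 2 * z * inner ℝ q w + inner ℝ w R) -
        2 * ε * ((2 * inner ℝ q w - 2 * z + r) * inner ℝ q w +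
          z * (2 * inner ℝ q (T w) - 2 * z * n ^ 2 + inner ℝ q R)) := by
    rw [hP]
    simp only [saddleLyapunovDeriv, add_apply, smul_apply,
      ContinuousLinearMap.comp_apply, ContinuousLinearMap.coe_fst', ContinuousLinearMap.coe_snd',
      innerSL_apply_apply, add_sub_cancel_left, inner_sub_left, inner_add_right, inner_sub_right,
      real_inner_smul_left, real_inner_smul_right, smul_eq_mul, real_inner_self_eq_norm_sq,
      real_inner_comm q w, ← hn]
    ring
  rw [hderiv]
  have hρC : (10 * C + 1) * ρ ≤ μ / 2 := by
    calc (10 * C + 1) * ρ ≤ (10 * C + 1) * (μ / 2 / (10 * C + 1)) := by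
          gcongr; exact min_le_right _ _
      _ = μ / 2 := by field_simp
  have hμ1 : μ ≤ 1 := min_le_left _ _
  have hμ2 : μ ≤ 2 * ε * κ := min_le_right _ _
  have f1 : (10 * C + 1) * ρ * (z ^ 2 + ‖w‖ ^ 2) ≤ μ / 2 * (z ^ 2 + ‖w‖ ^ 2) := by gcongr
  have f2 : μ * z ^ 2 ≤ 1 * z ^ 2 := by gcongr
  have f3 : μ * ‖w‖ ^ 2 ≤ 2 * ε * κ * ‖w‖ ^ 2 := by gcongr
  have f4 : μ * saddleLyapunov ε c₀ u₀ q (c₀ + z, u₀ + w) ≤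
      μ * (3 / 2 * (z ^ 2 + ‖w‖ ^ 2)) := by gcongr
  linarith

end Quadratic

/-! ### Rayleigh quotients and the largest eigenvalue -/

section Matrices

variable {n : ℕ}

theorem bilin_conicMatrix (G : Matrix (Fin n) (Fin n) ℝ) (c : ℝ) (u v : EuclideanSpace ℝ (Fin n)) :
    bilin (conicMatrix G c) u v =
      bilin (G.transpose * G) u v - c * bilin (G + G.transpose) u v + c ^ 2 * inner ℝ u v := by
  simp only [bilin, conicMatrix, map_add, map_sub, map_smul, LinearMap.add_apply,
    LinearMap.sub_apply, LinearMap.smul_apply, inner_add_right, inner_sub_right,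
    real_inner_smul_right, Matrix.toLpLin_one, LinearMap.id_apply]

theorem bilin_comm_of_isHermitian {M : Matrix (Fin n) (Fin n) ℝ} (hM : M.IsHermitian)
    (u v : EuclideanSpace ℝ (Fin n)) :
    inner ℝ u (M.toEuclideanLin v) = inner ℝ (M.toEuclideanLin u) v :=
  (Matrix.isSymmetric_toEuclideanLin_iff.2 hM u v).symm

theorem isHermitian_add_transpose (G : Matrix (Fin n) (Fin n) ℝ) :
    (G + G.transpose).IsHermitian := by
  rw [Matrix.IsHermitian, Matrix.conjTranspose_eq_transpose_of_trivial, Matrix.transpose_add,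
    Matrix.transpose_transpose, add_comm]

theorem isHermitian_conicMatrix (G : Matrix (Fin n) (Fin n) ℝ) (c : ℝ) :
    (conicMatrix G c).IsHermitian := by
  rw [Matrix.IsHermitian, Matrix.conjTranspose_eq_transpose_of_trivial, conicMatrix]
  simp only [Matrix.transpose_add, Matrix.transpose_sub, Matrix.transpose_smul,
    Matrix.transpose_mul, Matrix.transpose_transpose, Matrix.transpose_one]
  rw [add_comm G.transpose G]

theorem continuous_bilin (M : Matrix (Fin n) (Fin n) ℝ) :
    Continuous fun u : EuclideanSpace ℝ (Fin n) => bilin M u u := by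
  have : Continuous (M.toEuclideanLin) := LinearMap.continuous_of_finiteDimensional _
  exact continuous_id.inner this

theorem bilin_smul_smul (M : Matrix (Fin n) (Fin n) ℝ) (s : ℝ) (u : EuclideanSpace ℝ (Fin n)) :
    bilin M (s • u) (s • u) = s ^ 2 * bilin M u u := by
  simp only [bilin, map_smul, real_inner_smul_left, real_inner_smul_right]
  ring

/-- A maximizer of the Rayleigh quotient is an eigenvector. -/
theorem toEuclideanLin_eq_smul_of_bilin_eq {M : Matrix (Fin n) (Fin n) ℝ} (hM : M.IsHermitian)
    {μ : ℝ} (hμ : ∀ v, bilin M v v ≤ μ * ‖v‖ ^ 2) {u : EuclideanSpace ℝ (Fin n)}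
    (hu : bilin M u u = μ * ‖u‖ ^ 2) : M.toEuclideanLin u = μ • u := by
  set T : EuclideanSpace ℝ (Fin n) →L[ℝ] EuclideanSpace ℝ (Fin n) :=
    M.toEuclideanLin.toContinuousLinearMap - μ • ContinuousLinearMap.id ℝ _ with hT
  have hTa : ∀ v, T v = M.toEuclideanLin v - μ • v := fun v => rfl
  have hTi : ∀ v, inner ℝ v (T v) = bilin M v v - μ * ‖v‖ ^ 2 := fun v => by
    rw [hTa, inner_sub_right, real_inner_smul_right, real_inner_self_eq_norm_sq, bilin]
  have h0 : T u = 0 := eq_zero_of_inner_map_self_eq_zero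
    (fun v w => by
      rw [hTa, hTa, inner_sub_right, inner_sub_left, bilin_comm_of_isHermitian hM,
        real_inner_smul_left, real_inner_smul_right])
    (fun v => by rw [hTi]; linarith [hμ v]) (by rw [hTi, hu, sub_self])
  rwa [hTa, sub_eq_zero] at h0

/-- The variational characterization of the largest eigenvalue. -/
theorem exists_isMax_bilin_and_lambda1 (hn : 1 ≤ n) {M : Matrix (Fin n) (Fin n) ℝ}
    (hM : M.IsHermitian) :
    (∃ u : EuclideanSpace ℝ (Fin n), ‖u‖ = 1 ∧ bilin M u u = lambda1 M) ∧
      ∀ v, bilin M v v ≤ lambda1 M * ‖v‖ ^ 2 := by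
  have : Nonempty (Fin n) := ⟨⟨0, hn⟩⟩
  have hne : (Metric.sphere (0 : EuclideanSpace ℝ (Fin n)) 1).Nonempty :=
    NormedSpace.sphere_nonempty.2 zero_le_one
  obtain ⟨u, hu, hmax⟩ := (isCompact_sphere (0 : EuclideanSpace ℝ (Fin n)) 1).exists_isMaxOn hne
    (continuous_bilin M).continuousOn
  have hu1 : ‖u‖ = 1 := by simpa using hu
  have hle : ∀ v, bilin M v v ≤ bilin M u u * ‖v‖ ^ 2 := by
    intro v
    by_cases hv : v = 0
    · simp [hv, bilin]
    have hvn : ‖v‖ ≠ 0 := norm_ne_zero_iff.2 hv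
    have h1 : bilin M (‖v‖⁻¹ • v) (‖v‖⁻¹ • v) ≤ bilin M u u :=
      hmax (show ‖v‖⁻¹ • v ∈ Metric.sphere (0 : EuclideanSpace ℝ (Fin n)) 1 by
        simp [norm_smul, inv_mul_cancel₀ hvn])
    rw [bilin_smul_smul] at h1
    calc bilin M v v = (‖v‖⁻¹ ^ 2 * bilin M v v) * ‖v‖ ^ 2 := by field_simp
      _ ≤ _ := by gcongr
  have hgreat : IsGreatest {μ : ℝ | Module.End.HasEigenvalue (Matrix.toEuclideanLin M) μ}
      (bilin M u u) := by
    constructor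
    · have h := toEuclideanLin_eq_smul_of_bilin_eq hM hle (u := u) (by simp [hu1])
      exact Module.End.hasEigenvalue_of_hasEigenvector
        (Module.End.hasEigenvector_iff.2 ⟨Module.End.mem_eigenspace_iff.2 h, by
          rintro rfl; simp at hu1⟩)
    · intro μ hμ
      obtain ⟨v, hv⟩ := hμ.exists_hasEigenvector
      have hv0 : 0 < ‖v‖ ^ 2 := by have := norm_pos_iff.2 hv.2; positivity
      have h1 := hle v
      rw [bilin, hv.apply_eq_smul, real_inner_smul_right, real_inner_self_eq_norm_sq] at h1
      exact le_of_mul_le_mul_right h1 hv0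
  have hl : lambda1 M = bilin M u u := hgreat.csSup_eq
  exact ⟨⟨u, hu1, hl.symm⟩, hl ▸ hle⟩

/-- Turns the eigenvector condition into a scalar equation, which passes to limits. -/
theorem hasEigenvector_lambda1_iff (hn : 1 ≤ n) {M : Matrix (Fin n) (Fin n) ℝ}
    (hM : M.IsHermitian) {u : EuclideanSpace ℝ (Fin n)} (hu : ‖u‖ = 1) :
    Module.End.HasEigenvector (Matrix.toEuclideanLin M) (lambda1 M) u ↔
      bilin M u u = lambda1 M := by
  constructor
  · intro h
    rw [bilin, h.apply_eq_smul, real_inner_smul_right, real_inner_self_eq_norm_sq, hu]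
    ring
  · intro h
    exact Module.End.hasEigenvector_iff.2 ⟨Module.End.mem_eigenspace_iff.2
      (toEuclideanLin_eq_smul_of_bilin_eq hM (exists_isMax_bilin_and_lambda1 hn hM).2
        (by rw [h, hu]; ring)), by rintro rfl; simp at hu⟩

/-! ### Minimizing `λ₁(A(c))` over `c` -/

theorem continuous_bilin_conicMatrix (G : Matrix (Fin n) (Fin n) ℝ) :
    Continuous fun x : ℝ × EuclideanSpace ℝ (Fin n) => bilin (conicMatrix G x.1) x.2 x.2 := by
  simp only [bilin_conicMatrix]
  have h1 := (continuous_bilin (G.transpose * G)).comp (continuous_snd (X := ℝ))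
  have h2 := (continuous_bilin (G + G.transpose)).comp (continuous_snd (X := ℝ))
  simp only [Function.comp_def] at h1 h2
  fun_prop

theorem continuous_lambda1_conicMatrix (hn : 1 ≤ n) (G : Matrix (Fin n) (Fin n) ℝ) :
    Continuous fun c : ℝ => lambda1 (conicMatrix G c) := by
  have h := (isCompact_sphere (0 : EuclideanSpace ℝ (Fin n)) 1).continuous_sSup
    (f := fun c u => bilin (conicMatrix G c) u u) (continuous_bilin_conicMatrix G)
  convert! h using 2 with c
  obtain ⟨⟨u, hu, hmax⟩, hle⟩ := exists_isMax_bilin_and_lambda1 hn (isHermitian_conicMatrix G c)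
  have hgr : IsGreatest ((fun v => bilin (conicMatrix G c) v v) ''
      Metric.sphere (0 : EuclideanSpace ℝ (Fin n)) 1) (lambda1 (conicMatrix G c)) := by
    refine ⟨⟨u, by simpa using hu, hmax⟩, ?_⟩
    rintro _ ⟨v, hv, rfl⟩
    have hv1 : ‖v‖ = 1 := by simpa using hv
    simpa [hv1] using hle v
  exact hgr.csSup_eq.symm

/-- Coercivity comes from testing with one fixed unit vector `e`: `λ₁(A(c)) ≥ c² - cs + b ≥ c²/2 + b
- s²/2`. Only the norm of `e` matters. -/
theorem exists_isMinOn_lambda1 (hn : 1 ≤ n) (G : Matrix (Fin n) (Fin n) ℝ) :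
    ∃ c : ℝ, IsMinOn (fun c' : ℝ => lambda1 (conicMatrix G c')) univ c := by
  obtain ⟨⟨e, he, -⟩, -⟩ := exists_isMax_bilin_and_lambda1 hn (isHermitian_conicMatrix G 0)
  set s := bilin (G + G.transpose) e e
  set b := bilin (G.transpose * G) e e
  have hlow : ∀ c : ℝ, ‖c‖ ^ 2 / 2 + (b - s ^ 2 / 2) ≤ lambda1 (conicMatrix G c) := by
    intro c
    have h := (exists_isMax_bilin_and_lambda1 hn (isHermitian_conicMatrix G c)).2 e
    rw [bilin_conicMatrix, real_inner_self_eq_norm_sq, he] at h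
    rw [Real.norm_eq_abs, sq_abs]
    nlinarith [sq_nonneg (c - s)]
  have htend : Filter.Tendsto (fun c : ℝ => ‖c‖ ^ 2 / 2 + (b - s ^ 2 / 2))
      (Filter.cocompact ℝ) Filter.atTop :=
    Filter.tendsto_atTop_add_const_right _ _ (((Filter.tendsto_pow_atTop two_ne_zero).comp
      (tendsto_norm_cocompact_atTop (E := ℝ))).atTop_div_const two_pos)
  obtain ⟨c, hc⟩ := (continuous_lambda1_conicMatrix hn G).exists_forall_le
    (Filter.tendsto_atTop_mono hlow htend)
  exact ⟨c, fun c' _ => hc c'⟩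

/-- Strong convexity: take `u` optimal at the midpoint. Its quadratic `ρ₃(·, u)` is at the midpoint
`(c₁ - c₂)²/4` below the average of its endpoint values, yet minimality makes the midpoint value at
least both endpoint values. -/
theorem isMinOn_lambda1_unique (hn : 1 ≤ n) (G : Matrix (Fin n) (Fin n) ℝ) {c₁ c₂ : ℝ}
    (h₁ : IsMinOn (fun c' : ℝ => lambda1 (conicMatrix G c')) univ c₁)
    (h₂ : IsMinOn (fun c' : ℝ => lambda1 (conicMatrix G c')) univ c₂) : c₁ = c₂ := by
  obtain ⟨⟨u, hu, hmax⟩, -⟩ :=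
    exists_isMax_bilin_and_lambda1 hn (isHermitian_conicMatrix G ((c₁ + c₂) / 2))
  have b₁ := (exists_isMax_bilin_and_lambda1 hn (isHermitian_conicMatrix G c₁)).2 u
  have b₂ := (exists_isMax_bilin_and_lambda1 hn (isHermitian_conicMatrix G c₂)).2 u
  have m₁ : lambda1 (conicMatrix G c₁) ≤ lambda1 (conicMatrix G ((c₁ + c₂) / 2)) :=
    h₁ (mem_univ _)
  have m₂ : lambda1 (conicMatrix G c₂) ≤ lambda1 (conicMatrix G ((c₁ + c₂) / 2)) :=
    h₂ (mem_univ _)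
  rw [bilin_conicMatrix, real_inner_self_eq_norm_sq, hu] at hmax b₁ b₂
  have : (c₁ - c₂) ^ 2 ≤ 0 := by nlinarith
  exact sub_eq_zero.1 (pow_eq_zero_iff two_ne_zero |>.1 (le_antisymm this (sq_nonneg _)))

/-- One-sided optimality condition at a minimizer of `λ₁(A(·))`, in the direction `σ`. -/
theorem exists_maximizer_of_isMinOn (hn : 1 ≤ n) (G : Matrix (Fin n) (Fin n) ℝ) {c : ℝ}
    (hc : IsMinOn (fun c' : ℝ => lambda1 (conicMatrix G c')) univ c) (σ : ℝ) :
    ∃ u : EuclideanSpace ℝ (Fin n), ‖u‖ = 1 ∧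
      bilin (conicMatrix G c) u u = lambda1 (conicMatrix G c) ∧
      σ * (bilin (G + G.transpose) u u - 2 * c) ≤ 0 := by
  set d : ℕ → ℝ := fun k => c + σ * (1 / ((k : ℝ) + 1)) with hd
  have hdc : Filter.Tendsto d Filter.atTop (𝓝 c) := by
    simpa [hd] using (tendsto_one_div_add_atTop_nhds_zero_nat (𝕜 := ℝ)).const_mul σ |>.const_add c
  choose v hv hvmax using fun k : ℕ =>
    (exists_isMax_bilin_and_lambda1 hn (isHermitian_conicMatrix G (d k))).1
  -- `ρ₃(c, v k) ≤ λ₁(A(c)) ≤ λ₁(A(d k)) = ρ₃(d k, v k)`; the difference of the outer terms factors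
  -- as `(d k - c)(d k + c - vᵀ(G + Gᵀ)v)`, with `v = v k`. A limit point of the `v k` is the
  -- desired maximizer.
  have hvσ : ∀ k, σ * (bilin (G + G.transpose) (v k) (v k) - d k - c) ≤ 0 := by
    intro k
    have h1 := (exists_isMax_bilin_and_lambda1 hn (isHermitian_conicMatrix G c)).2 (v k)
    have h2 : lambda1 (conicMatrix G c) ≤ lambda1 (conicMatrix G (d k)) := hc (mem_univ _)
    rw [← hvmax, bilin_conicMatrix, real_inner_self_eq_norm_sq, hv] at h2
    rw [bilin_conicMatrix, real_inner_self_eq_norm_sq, hv] at h1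
    have hk : (0 : ℝ) < 1 / ((k : ℝ) + 1) := by positivity
    have h3 : σ * (1 / ((k : ℝ) + 1)) = d k - c := by simp [hd]
    have h4 : (1 / ((k : ℝ) + 1)) * (σ * (bilin (G + G.transpose) (v k) (v k) - d k - c)) ≤ 0 := by
      calc _ = (σ * (1 / ((k : ℝ) + 1))) * (bilin (G + G.transpose) (v k) (v k) - d k - c) := by
            ring
        _ ≤ 0 := by rw [h3]; nlinarith
    by_contra hpos
    exact absurd h4 (not_le.2 (mul_pos hk (not_le.1 hpos)))
  obtain ⟨u, hu, φ, hφ, hlim⟩ := (isCompact_sphere (0 : EuclideanSpace ℝ (Fin n)) 1).tendsto_subseq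
    (x := v) (fun k => by simpa using hv k)
  have hdφ := hdc.comp hφ.tendsto_atTop
  refine ⟨u, by simpa using hu, ?_, ?_⟩
  · have h1 := ((continuous_bilin_conicMatrix G).tendsto (c, u)).comp (hdφ.prodMk_nhds hlim)
    have h2 := ((continuous_lambda1_conicMatrix hn G).tendsto c).comp hdφ
    refine tendsto_nhds_unique h1 (h2.congr fun k => ?_)
    exact (hvmax (φ k)).symm
  · have h1 := ((continuous_bilin (G + G.transpose)).tendsto u).comp hlim
    have h2 := ((h1.sub hdφ).sub_const c).const_mul σ
    have h3 := le_of_tendsto' h2 fun k => hvσ (φ k)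
    linarith

/-- The directions `σ = ±1` give top eigenvectors on which `wᵀ(G + Gᵀ)w - 2c‖w‖²` has opposite weak
signs. It vanishes somewhere on the segment joining them, which lies in the eigenspace; normalizing
gives the pair. -/
theorem exists_isMinRadiusPair (hn : 1 ≤ n) (G : Matrix (Fin n) (Fin n) ℝ) {c : ℝ}
    (hc : IsMinOn (fun c' : ℝ => lambda1 (conicMatrix G c')) univ c) :
    ∃ u, IsMinRadiusPair G c u := by
  have hH := isHermitian_conicMatrix G c
  suffices h : ∃ w : EuclideanSpace ℝ (Fin n), w ≠ 0 ∧
      (conicMatrix G c).toEuclideanLin w = lambda1 (conicMatrix G c) • w ∧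
      bilin (G + G.transpose) w w - 2 * c * ‖w‖ ^ 2 = 0 by
    obtain ⟨w, hw, hev, hs⟩ := h
    have hwn : ‖w‖ ≠ 0 := norm_ne_zero_iff.2 hw
    have hu : ‖‖w‖⁻¹ • w‖ = 1 := by simp [norm_smul, inv_mul_cancel₀ hwn]
    refine ⟨‖w‖⁻¹ • w, hc, hu, ?_, ?_⟩
    · refine Module.End.hasEigenvector_iff.2 ⟨Module.End.mem_eigenspace_iff.2 ?_, ?_⟩
      · rw [map_smul, hev, smul_comm]
      · intro h0; rw [h0, norm_zero] at hu; exact zero_ne_one hu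
    · rw [bilin_smul_smul, show bilin (G + G.transpose) w w = 2 * c * ‖w‖ ^ 2 by linarith]
      field_simp
      ring
  obtain ⟨u, hu, hue, hus⟩ := exists_maximizer_of_isMinOn hn G hc 1
  obtain ⟨v, hv, hve, hvs⟩ := exists_maximizer_of_isMinOn hn G hc (-1)
  have hue' := ((hasEigenvector_lambda1_iff hn hH hu).2 hue).apply_eq_smul
  have hve' := ((hasEigenvector_lambda1_iff hn hH hv).2 hve).apply_eq_smul
  set w : ℝ → EuclideanSpace ℝ (Fin n) := fun t => (1 - t) • u + t • v with hw
  have hwc : Continuous w := by fun_prop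
  have hφ : Continuous fun t => bilin (G + G.transpose) (w t) (w t) - 2 * c * ‖w t‖ ^ 2 :=
    ((continuous_bilin _).comp hwc).sub (by fun_prop)
  have h0 : bilin (G + G.transpose) (w 0) (w 0) - 2 * c * ‖w 0‖ ^ 2 ≤ 0 := by
    simp only [hw, sub_zero, one_smul, zero_smul, add_zero, hu]; linarith
  have h1 : 0 ≤ bilin (G + G.transpose) (w 1) (w 1) - 2 * c * ‖w 1‖ ^ 2 := by
    simp only [hw, sub_self, one_smul, zero_smul, zero_add, hv]; linarith
  obtain ⟨t, ht, hzero⟩ := intermediate_value_Icc zero_le_one hφ.continuousOn ⟨h0, h1⟩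
  -- The segment can meet the origin only if `v = -u`. Then both inequalities concern the same
  -- value, so `u` itself works.
  by_cases hwt : w t = 0
  · have ht2 : t = 1 / 2 := by
      have h2 : ‖(1 - t) • u‖ = ‖t • v‖ := by
        rw [eq_neg_of_add_eq_zero_left hwt, norm_neg]
      rw [norm_smul, norm_smul, hu, hv, Real.norm_of_nonneg (by linarith [ht.2]),
        Real.norm_of_nonneg ht.1] at h2
      linarith
    have huv : u = (-1 : ℝ) • v := by
      have h3 : (1 - t) • u + t • v = 0 := hwt
      rw [ht2] at h3
      have h4 : (2 : ℝ) • ((1 - 1 / 2 : ℝ) • u + (1 / 2 : ℝ) • v) = 0 := by rw [h3, smul_zero]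
      have h5 : u + v = 0 := by rw [← h4]; module
      rw [neg_one_smul]; exact eq_neg_of_add_eq_zero_left h5
    have hsuv : bilin (G + G.transpose) u u = bilin (G + G.transpose) v v := by
      rw [huv, bilin_smul_smul]; norm_num
    refine ⟨u, by rintro rfl; simp at hu, hue', ?_⟩
    rw [hu]
    linarith
  · refine ⟨w t, hwt, ?_, hzero⟩
    simp only [hw, map_add, map_smul, hue', hve']
    module

theorem rho3_eq_minRadiusSq (hn : 1 ≤ n) {G : Matrix (Fin n) (Fin n) ℝ} {c : ℝ}
    {u : EuclideanSpace ℝ (Fin n)} (h : IsMinRadiusPair G c u) : rho3 G c u = minRadiusSq G := by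
  have hsup : ∀ c' : ℝ, ⨆ v : {v : EuclideanSpace ℝ (Fin n) // v ≠ 0}, rho3 G c' v =
      lambda1 (conicMatrix G c') := by
    intro c'
    obtain ⟨⟨v, hv, hmax⟩, hle⟩ := exists_isMax_bilin_and_lambda1 hn (isHermitian_conicMatrix G c')
    have hv0 : v ≠ 0 := by rintro rfl; simp at hv
    refine IsLUB.csSup_eq (IsGreatest.isLUB ⟨⟨⟨v, hv0⟩, ?_⟩, ?_⟩) ⟨_, ⟨v, hv0⟩, rfl⟩
    · simp [rho3, hmax, hv]
    · rintro _ ⟨⟨w, hw⟩, rfl⟩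
      have : 0 < ‖w‖ ^ 2 := by have := norm_pos_iff.2 hw; positivity
      exact (div_le_iff₀ this).2 (hle w)
  have h1 : rho3 G c u = lambda1 (conicMatrix G c) := by
    rw [rho3, (hasEigenvector_lambda1_iff hn (isHermitian_conicMatrix G c) h.norm_eq_one).1
      h.eigenvector, h.norm_eq_one]
    simp
  rw [h1, minRadiusSq]
  simp only [hsup]
  have hleast : IsLeast (range fun c' : ℝ => lambda1 (conicMatrix G c'))
      (lambda1 (conicMatrix G c)) :=
    ⟨⟨c, rfl⟩, by rintro _ ⟨c', rfl⟩; exact h.isMinOn (mem_univ c')⟩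
  exact hleast.csInf_eq.symm

/-! ### The saddle-point field on and off the sphere -/

theorem gradient_rho3 (G : Matrix (Fin n) (Fin n) ℝ) (c : ℝ) {u : EuclideanSpace ℝ (Fin n)}
    (hu : u ≠ 0) :
    gradient (fun u : EuclideanSpace ℝ (Fin n) => rho3 G c u) u =
      (2 / ‖u‖ ^ 2) • ((conicMatrix G c).toEuclideanLin u - rho3 G c u • u) := by
  set M := conicMatrix G c with hM
  have hMh : M.IsHermitian := isHermitian_conicMatrix G c
  have hun : ‖u‖ ^ 2 ≠ 0 := pow_ne_zero 2 (norm_ne_zero_iff.2 hu)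
  have hid := hasFDerivAt_id (𝕜 := ℝ) u
  have hnum : HasFDerivAt (fun v : EuclideanSpace ℝ (Fin n) => bilin M v v) _ u :=
    hid.inner ℝ (M.toEuclideanLin.toContinuousLinearMap.hasFDerivAt (x := u))
  have hden : HasFDerivAt (fun v : EuclideanSpace ℝ (Fin n) => ‖v‖ ^ 2) _ u := hid.norm_sq
  have hdiv := hnum.mul ((hasDerivAt_inv hun).comp_hasFDerivAt u hden)
  refine HasGradientAt.gradient (hasGradientAt_iff_hasFDerivAt.2 (hdiv.congr_fderiv ?_))
  ext v
  have h1 : inner ℝ v (M.toEuclideanLin u) = inner ℝ (M.toEuclideanLin u) v :=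
    real_inner_comm _ _
  have h2 : inner ℝ u (M.toEuclideanLin v) = inner ℝ (M.toEuclideanLin u) v :=
    bilin_comm_of_isHermitian hMh u v
  simp [rho3, ← hM, h1, h2]
  field_simp
  ring

/-- `ρ₃(c, ·)` is homogeneous of degree 0, so its gradient has no radial part. Hence `‖u‖²` is a
first integral and the sphere is invariant. -/
theorem inner_saddleField_snd (G : Matrix (Fin n) (Fin n) ℝ)
    (x : ℝ × EuclideanSpace ℝ (Fin n)) : inner ℝ x.2 (saddleField G x).2 = 0 := by
  by_cases hx : x.2 = 0
  · rw [hx, inner_zero_left]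
  have hun : ‖x.2‖ ≠ 0 := norm_ne_zero_iff.2 hx
  rw [saddleField, gradient_rho3 G x.1 hx, real_inner_smul_right, inner_sub_right,
    real_inner_smul_right, real_inner_self_eq_norm_sq, rho3, bilin]
  field_simp
  ring

theorem saddleField_of_norm_eq_one (G : Matrix (Fin n) (Fin n) ℝ) (c : ℝ)
    {u : EuclideanSpace ℝ (Fin n)} (hu : ‖u‖ = 1) :
    saddleField G (c, u) = (bilin (G + G.transpose) u u - 2 * c,
      (2 : ℝ) • ((conicMatrix G c).toEuclideanLin u - bilin (conicMatrix G c) u u • u)) := by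
  have hu0 : u ≠ 0 := by rintro rfl; simp at hu
  refine Prod.ext ?_ ?_
  · have hd : HasDerivAt (fun c : ℝ => rho3 G c u)
        (-(1 * bilin (G + G.transpose) u u) + 2 * c) c := by
      have h : (fun c : ℝ => rho3 G c u) = fun c => bilin (G.transpose * G) u u -
          c * bilin (G + G.transpose) u u + c ^ 2 := by
        funext c
        rw [rho3, bilin_conicMatrix, real_inner_self_eq_norm_sq, hu]
        ring
      rw [h]
      refine HasDerivAt.add (HasDerivAt.const_sub _ ((hasDerivAt_id c).mul_const _)) ?_
      simpa using hasDerivAt_pow 2 c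
    simp only [saddleField, hd.deriv]
    ring
  · simp only [saddleField]
    rw [gradient_rho3 G c hu0, rho3, hu]
    norm_num

theorem saddleField_eq_zero (hn : 1 ≤ n) {G : Matrix (Fin n) (Fin n) ℝ} {c : ℝ}
    {u : EuclideanSpace ℝ (Fin n)} (h : IsMinRadiusPair G c u) : saddleField G (c, u) = 0 := by
  rw [saddleField_of_norm_eq_one G c h.norm_eq_one, h.eigenvector.apply_eq_smul,
    (hasEigenvector_lambda1_iff hn (isHermitian_conicMatrix G c) h.norm_eq_one).1 h.eigenvector,
    sub_self, smul_zero]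
  have := h.center_eq
  exact Prod.ext (by simp only [Prod.fst_zero]; linarith) rfl

/-! ### Transversality on the leading eigenspace and stability -/

/-- Orthogonal nonzero vectors of a subspace are at most as many as its dimension. -/
theorem card_le_finrank_of_orthogonal {E : Type*} [NormedAddCommGroup E] [InnerProductSpace ℝ E]
    [FiniteDimensional ℝ E] (K : Submodule ℝ E) {ι : Type*} [Fintype ι] (v : ι → E)
    (hv : ∀ i, v i ∈ K) (hv0 : ∀ i, v i ≠ 0) (ho : ∀ i j, i ≠ j → inner ℝ (v i) (v j) = 0) :
    Fintype.card ι ≤ Module.finrank ℝ K := by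
  have hli : LinearIndependent ℝ (fun i => (⟨v i, hv i⟩ : K)) :=
    linearIndependent_of_ne_zero_of_inner_eq_zero (𝕜 := ℝ)
      (fun i h => hv0 i (congrArg Subtype.val h)) (fun i j hij => ho i j hij)
  exact hli.fintype_card_le_finrank

/-- The transversality condition on the leading eigenspace. -/
theorem eq_zero_of_mem_eigenspace_of_orthogonal {G : Matrix (Fin n) (Fin n) ℝ} {c : ℝ}
    {u : EuclideanSpace ℝ (Fin n)} (h : IsMinRadiusPair G c u)
    (hmult : lambda1Multiplicity (conicMatrix G c) = 1 ∨
      (lambda1Multiplicity (conicMatrix G c) = 2 ∧ Assumption1 G c u))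
    {w : EuclideanSpace ℝ (Fin n)}
    (hw : (conicMatrix G c).toEuclideanLin w = lambda1 (conicMatrix G c) • w)
    (huw : inner ℝ u w = 0) (hSw : bilin (G + G.transpose) u w = 0) : w = 0 := by
  set K := Module.End.eigenspace (Matrix.toEuclideanLin (conicMatrix G c))
    (lambda1 (conicMatrix G c)) with hK
  have hwK : w ∈ K := Module.End.mem_eigenspace_iff.2 hw
  have huK : u ∈ K := h.eigenvector.1
  have hu0 : u ≠ 0 := h.eigenvector.2
  rcases hmult with h1 | ⟨h2, v, hv, hvu, hSv⟩
  · by_contra hw0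
    have := card_le_finrank_of_orthogonal K ![u, w]
      (by intro i; fin_cases i <;> assumption) (by intro i; fin_cases i <;> assumption)
      (by intro i j hij; fin_cases i <;> fin_cases j <;> simp_all [real_inner_comm])
    rw [Fintype.card_fin] at this
    exact absurd (this.trans_eq h1) (by norm_num)
  · have hvK : v ∈ K := hv.1
    have hv0 : v ≠ 0 := hv.2
    have huv : inner ℝ u v = 0 := by rw [real_inner_comm]; exact hvu
    have hvn : ‖v‖ ≠ 0 := norm_ne_zero_iff.2 hv0
    set a : ℝ := inner ℝ v w / ‖v‖ ^ 2 with ha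
    -- Otherwise `u`, `v` and the part of `w` orthogonal to `v` would be three orthogonal nonzero
    -- vectors in a plane. So `w` is a multiple of `v`, and Assumption 1 makes the factor zero.
    have hy : w - a • v = 0 := by
      by_contra hy0
      have hyK : w - a • v ∈ K := K.sub_mem hwK (K.smul_mem _ hvK)
      have huy : inner ℝ u (w - a • v) = 0 := by
        rw [inner_sub_right, real_inner_smul_right, huw, huv]; ring
      have hvy : inner ℝ v (w - a • v) = 0 := by
        rw [inner_sub_right, real_inner_smul_right, real_inner_self_eq_norm_sq, ha]
        field_simp
        ring
      generalize w - a • v = y at hy0 hyK huy hvy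
      have hyu : inner ℝ y u = 0 := by rw [real_inner_comm]; exact huy
      have hyv : inner ℝ y v = 0 := by rw [real_inner_comm]; exact hvy
      have := card_le_finrank_of_orthogonal K ![u, v, y]
        (by intro i; fin_cases i <;> assumption) (by intro i; fin_cases i <;> assumption)
        (by intro i j hij; fin_cases i <;> fin_cases j <;> first | exact absurd rfl hij | assumption)
      rw [Fintype.card_fin] at this
      exact absurd (this.trans_eq h2) (by norm_num)
    have hwa : w = a • v := sub_eq_zero.1 hy
    rw [hwa, bilin, map_smul, real_inner_smul_right] at hSw
    rw [hwa, (mul_eq_zero.1 hSw).resolve_right hSv, zero_smul]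

theorem isLocallyExpStableOn_saddleField (hn : 1 ≤ n) {G : Matrix (Fin n) (Fin n) ℝ} {c : ℝ}
    {u : EuclideanSpace ℝ (Fin n)} (h : IsMinRadiusPair G c u)
    (hmult : lambda1Multiplicity (conicMatrix G c) = 1 ∨
      (lambda1Multiplicity (conicMatrix G c) = 2 ∧ Assumption1 G c u)) :
    IsLocallyExpStableOn (saddleField G) (stateManifold n) (c, u) := by
  have hH := isHermitian_conicMatrix G c
  have hu := h.norm_eq_one
  set l := lambda1 (conicMatrix G c) with hl
  set S : EuclideanSpace ℝ (Fin n) →L[ℝ] EuclideanSpace ℝ (Fin n) :=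
    (G + G.transpose).toEuclideanLin.toContinuousLinearMap with hSdef
  set T : EuclideanSpace ℝ (Fin n) →L[ℝ] EuclideanSpace ℝ (Fin n) :=
    (conicMatrix G c).toEuclideanLin.toContinuousLinearMap - l • ContinuousLinearMap.id ℝ _
    with hTdef
  have hSa : ∀ v, S v = (G + G.transpose).toEuclideanLin v := fun v => rfl
  have hTa : ∀ v, T v = (conicMatrix G c).toEuclideanLin v - l • v := fun v => rfl
  have hS : ∀ v w, inner ℝ v (S w) = inner ℝ (S v) w :=
    fun v w => bilin_comm_of_isHermitian (isHermitian_add_transpose G) v w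
  have hT : ∀ v w, inner ℝ v (T w) = inner ℝ (T v) w := fun v w => by
    rw [hTa, hTa, inner_sub_right, inner_sub_left, bilin_comm_of_isHermitian hH,
      real_inner_smul_left, real_inner_smul_right]
  have hneg : ∀ w, inner ℝ w (T w) ≤ 0 := fun w => by
    have := (exists_isMax_bilin_and_lambda1 hn hH).2 w
    rw [bilin] at this
    rw [hTa, inner_sub_right, real_inner_smul_right, real_inner_self_eq_norm_sq]
    linarith
  have hTu : T u = 0 := by rw [hTa, h.eigenvector.apply_eq_smul, sub_self]
  have hcu : inner ℝ u (S u) = 2 * c := by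
    have := h.center_eq
    rw [bilin] at this
    rw [hSa]
    linarith
  obtain ⟨ε, hε, hεq, α, hα, r, hr, hdec⟩ := exists_saddleLyapunov_decay hS hT hneg hu hTu hcu
    (fun w h1 h2 h3 => eq_zero_of_mem_eigenspace_of_orthogonal h hmult
      (sub_eq_zero.1 ((hTa w).symm.trans h1)) h2 ((hS u w).trans h3))
  have hM : ∀ x : ℝ × EuclideanSpace ℝ (Fin n), x ∈ stateManifold n ↔ ‖x.2‖ ^ 2 = 1 := fun x => by
    rw [pow_eq_one_iff_of_nonneg (norm_nonneg x.2) two_ne_zero]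
    simp [stateManifold]
  have hM1 : ∀ x ∈ stateManifold n, ‖x.2‖ = 1 := fun x hx => by
    simpa [stateManifold] using hx
  have hV := saddleLyapunov_bounds (q := S u - (2 * c) • u) hε.le hεq c u
  have hnorm : ∀ x : ℝ × EuclideanSpace ℝ (Fin n),
      ‖x - (c, u)‖ ^ 2 ≤ (x.1 - c) ^ 2 + ‖x.2 - u‖ ^ 2 ∧
        (x.1 - c) ^ 2 + ‖x.2 - u‖ ^ 2 ≤ 2 * ‖x - (c, u)‖ ^ 2 := by
    intro x
    rw [Prod.norm_def, Prod.fst_sub, Prod.snd_sub, Real.norm_eq_abs, ← sq_abs (x.1 - c)]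
    have h1 := abs_nonneg (x.1 - c)
    have h2 := norm_nonneg (x.2 - u)
    rcases max_cases |x.1 - c| ‖x.2 - u‖ with ⟨h3, h4⟩ | ⟨h3, h4⟩ <;> rw [h3] <;>
      constructor <;> nlinarith
  -- The product carries the sup norm, so `z² + ‖w‖²` lies between `‖x - x₀‖²` and twice it. Thus `V
  -- ≥ ½‖x - x₀‖²` and `V ≤ 3‖x - x₀‖² ≤ ½(3‖x - x₀‖)²`, whence `a = 1/2`, `k = 3`.
  refine isLocallyExpStableOn_of_lyapunov (P := polySaddleField S T c)
    (h := fun x => ‖x.2‖ ^ 2) (h' := fun x => (2 : ℝ) • (innerSL ℝ x.2).comp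
      (ContinuousLinearMap.snd ℝ ℝ (EuclideanSpace ℝ (Fin n)))) (c₀ := 1)
    (a := 1 / 2) (k := 3) (fun x => ?_) (fun x => ?_) (fun x => ?_) hM (fun x hx => ?_)
    (contDiff_polySaddleField S T c) ((hM _).2 (by simp [hu])) (saddleField_eq_zero hn h)
    (hasFDerivAt_saddleLyapunov ε c u (S u - (2 * c) • u)) (by norm_num) (by norm_num) hα hr
    (fun x => ?_) (fun x => ?_) (fun x hx hxr => hdec x (hM1 x hx) hxr)
  · refine (hasFDerivAt_snd (𝕜 := ℝ) (p := x)).norm_sq.congr_fderiv ?_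
    rw [two_smul, two_smul]
  · simp [inner_saddleField_snd]
  · simp [inner_polySaddleField_snd]
  · obtain ⟨d, v⟩ := x
    have hv : ‖v‖ = 1 := hM1 (d, v) hx
    have hvv : (inner ℝ v v : ℝ) = 1 := by rw [real_inner_self_eq_norm_sq, hv]; norm_num
    rw [saddleField_of_norm_eq_one G d hv, polySaddleField]
    -- `A(d)` and `T - (d - c)S` differ by a multiple of the identity, which projection to the
    -- tangent space removes.
    have key : (conicMatrix G d).toEuclideanLin v =
        T v - (d - c) • S v + (d ^ 2 - c ^ 2 + l) • v := by
      rw [hTa, hSa]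
      simp only [conicMatrix, map_add, map_sub, map_smul, LinearMap.add_apply,
        LinearMap.sub_apply, LinearMap.smul_apply, Matrix.toLpLin_one, LinearMap.id_apply]
      module
    refine Prod.ext rfl ?_
    simp only [bilin, key, inner_add_right, real_inner_smul_right, hvv]
    module
  · linarith [(hV x).1, (hnorm x).1]
  · linarith [(hV x).2, (hnorm x).2, sq_nonneg ‖x - (c, u)‖]

end Matrices

theorem mainTheorem2 (n : ℕ) (hn : 1 ≤ n) (g : ℕ → ℝ) :
    (∃! c : ℝ, ∃ u : EuclideanSpace ℝ (Fin n), IsMinRadiusPair (convolutionMatrix n g) c u) ∧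
    ∀ (c : ℝ) (u : EuclideanSpace ℝ (Fin n)), IsMinRadiusPair (convolutionMatrix n g) c u →
      rho3 (convolutionMatrix n g) c u = minRadiusSq (convolutionMatrix n g) ∧
      saddleField (convolutionMatrix n g) (c, u) = 0 ∧
      ((lambda1Multiplicity (conicMatrix (convolutionMatrix n g) c) = 1 ∨
          (lambda1Multiplicity (conicMatrix (convolutionMatrix n g) c) = 2 ∧
            Assumption1 (convolutionMatrix n g) c u)) →
        IsLocallyExpStableOn (saddleField (convolutionMatrix n g)) (stateManifold n) (c, u)) := by
  refine ⟨?_, fun c u h => ⟨rho3_eq_minRadiusSq hn h, saddleField_eq_zero hn h,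
    isLocallyExpStableOn_saddleField hn h⟩⟩
  obtain ⟨c, hc⟩ := exists_isMinOn_lambda1 hn (convolutionMatrix n g)
  exact ⟨c, exists_isMinRadiusPair hn _ hc, fun c' ⟨_, h'⟩ =>
    isMinOn_lambda1_unique hn _ h'.isMinOn hc⟩
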